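/- Let $d \ge 2$ and let $\Omega \subset \mathbb{R}^d$ be a bounded open set of class $C^1$. Let $\gamma_1, \gamma_2 \in W^{1,1}(\Omega)$ be real-valued and such that, for each $j = 1, 2$, there is $\lambda > 0$ with $1/\lambda \le \gamma_j(x) \le \lambda$ for a.e. $x \in \Omega$. For such a conductivity $\gamma$, the Dirichlet-to-Neumann map $DtN_\gamma : H^{1/2}(\partial\Omega) \to H^{-1/2}(\partial\Omega)$ is defined by $DtN_\gamma(f) = \gamma \frac{\partial u}{\partial \eta}$, where $\eta$ is the exterior unit normal and $u \in H^1(\Omega)$ is the unique weak solution of $\operatorname{div}(\gamma \nabla u) = 0$ in $\Omega$ with $u = f$ on $\partial\Omega$. That is, $\langle DtN_\gamma(f), v|_{\partial\Omega} \rangle = \int_\Omega \gamma \nabla u \cdot \nabla v \, dx$ for all $v \in H^1(\Omega)$; here $H^{1/2}(\partial\Omega) = H^1(\Omega)/H^1_0(\Omega)$ is the space of boundary values of functions in $H^1(\Omega)$ and $H^{-1/2}(\partial\Omega)$ is its dual. If $DtN_{\gamma_1} = DtN_{\gamma_2}$, then $\gamma_1 = \gamma_2$ on $\partial\Omega$ in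 the sense of traces: for $\mathcal{H}^{d-1}$-a.e. $z \in \partial\Omega$ there is $a \in \mathbb{R}$ such that, for both $j = 1$ and $j = 2$, $$\lim_{r \to 0^+} \frac{1}{|B(z,r) \cap \Omega|} \int_{B(z,r) \cap \Omega} |\gamma_j(x) - a| \, dx = 0 .$$ -/

import Mathlib

open MeasureTheory Filter Topology Metric
open scoped ContDiff Gradient RealInnerProductSpace

noncomputable section

/-- An open subset of `ℝᵈ` of class `C¹`: near each boundary point, in a suitable orthonormal
frame with last vector `e`, the set is the region strictly above the graph of a `C¹` function.
The function `ψ` is only evaluated on the hyperplane orthogonal to `e`. -/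
structure IsC1OpenSet {d : ℕ} (Ω : Set (EuclideanSpace ℝ (Fin d))) : Prop where
  isOpen : IsOpen Ω
  exists_graph : ∀ z ∈ frontier Ω, ∃ r > 0, ∃ e : EuclideanSpace ℝ (Fin d), ‖e‖ = 1 ∧
    ∃ ψ : EuclideanSpace ℝ (Fin d) → ℝ, ContDiff ℝ 1 ψ ∧
      ∀ x ∈ ball z r, x ∈ Ω ↔ ψ (x - ⟪e, x⟫ • e) < ⟪e, x⟫

/-- Test functions on `Ω`, the elements of `C_c^∞(Ω)`. -/
structure IsTestFunction {d : ℕ} (Ω : Set (EuclideanSpace ℝ (Fin d)))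
    (φ : EuclideanSpace ℝ (Fin d) → ℝ) : Prop where
  smooth : ContDiff ℝ ∞ φ
  hasCompactSupport : HasCompactSupport φ
  tsupport_subset : tsupport φ ⊆ Ω

/-- `G` is the weak gradient of `u` in `Ω`: `∫_Ω u ∇φ = - ∫_Ω φ G` for all test functions `φ`.
It is used only for `u` and `G` that are locally integrable in `Ω`. -/
def IsWeakGradient {d : ℕ} (Ω : Set (EuclideanSpace ℝ (Fin d)))
    (u : EuclideanSpace ℝ (Fin d) → ℝ)
    (G : EuclideanSpace ℝ (Fin d) → EuclideanSpace ℝ (Fin d)) : Prop :=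
  ∀ φ : EuclideanSpace ℝ (Fin d) → ℝ, IsTestFunction Ω φ →
    ∫ x in Ω, u x • ∇ φ x = - ∫ x in Ω, φ x • G x

/-- The Sobolev space `W^{1,1}(Ω)`. -/
def MemW11 {d : ℕ} (Ω : Set (EuclideanSpace ℝ (Fin d)))
    (u : EuclideanSpace ℝ (Fin d) → ℝ) : Prop :=
  IntegrableOn u Ω ∧
    ∃ G : EuclideanSpace ℝ (Fin d) → EuclideanSpace ℝ (Fin d),
      IntegrableOn G Ω ∧ IsWeakGradient Ω u G

lemma IsTestFunction.integrable_smul_gradient {d : ℕ} {Ω : Set (EuclideanSpace ℝ (Fin d))}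
    {φ : EuclideanSpace ℝ (Fin d) → ℝ} (hφ : IsTestFunction Ω φ)
    (u : Lp ℝ 2 (volume.restrict Ω)) :
    IntegrableOn (fun x => u x • ∇ φ x) Ω := by
  have hc : Continuous (fun x => ∇ φ x) :=
    (InnerProductSpace.toDual ℝ (EuclideanSpace ℝ (Fin d))).symm.continuous.comp
      (hφ.smooth.continuous_fderiv (by simp))
  have hs : HasCompactSupport (fun x => ∇ φ x) :=
    (hφ.hasCompactSupport.fderiv ℝ).comp_left
      (g := (InnerProductSpace.toDual ℝ (EuclideanSpace ℝ (Fin d))).symm) (map_zero _)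
  exact memLp_one_iff_integrable.1
    ((hc.memLp_of_hasCompactSupport (p := 2) hs).smul (Lp.memLp u))

lemma IsTestFunction.integrable_smul {d : ℕ} {Ω : Set (EuclideanSpace ℝ (Fin d))}
    {φ : EuclideanSpace ℝ (Fin d) → ℝ} (hφ : IsTestFunction Ω φ)
    (G : Lp (EuclideanSpace ℝ (Fin d)) 2 (volume.restrict Ω)) :
    IntegrableOn (fun x => φ x • G x) Ω :=
  memLp_one_iff_integrable.1
    ((Lp.memLp G).smul
      (hφ.smooth.continuous.memLp_of_hasCompactSupport (p := 2) hφ.hasCompactSupport))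

/-- The Sobolev space `H¹(Ω)`: pairs `(u, G)` in `L²(Ω) × L²(Ω; ℝᵈ)` such that `G` is the weak
gradient of `u`, with the norm `(‖u‖² + ‖G‖²)^{1/2}`. -/
def H1 {d : ℕ} (Ω : Set (EuclideanSpace ℝ (Fin d))) :
    Submodule ℝ (WithLp 2
      (Lp ℝ 2 (volume.restrict Ω) × Lp (EuclideanSpace ℝ (Fin d)) 2 (volume.restrict Ω))) where
  carrier := {w | IsWeakGradient Ω w.fst w.snd}
  zero_mem' := by
    intro φ _
    have h1 : ∫ x in Ω, ((0 : Lp ℝ 2 (volume.restrict Ω)) : _ → ℝ) x • ∇ φ x = 0 := by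
      refine integral_eq_zero_of_ae ?_
      filter_upwards [Lp.coeFn_zero ℝ 2 (volume.restrict Ω)] with x hx
      rw [hx]
      simp
    have h2 : ∫ x in Ω, φ x • ((0 : Lp (EuclideanSpace ℝ (Fin d)) 2 (volume.restrict Ω)) :
        _ → EuclideanSpace ℝ (Fin d)) x = 0 := by
      refine integral_eq_zero_of_ae ?_
      filter_upwards [Lp.coeFn_zero (EuclideanSpace ℝ (Fin d)) 2 (volume.restrict Ω)] with x hx
      rw [hx]
      simp
    simp only [WithLp.zero_fst, WithLp.zero_snd]
    rw [h1, h2, neg_zero]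
  add_mem' := by
    intro v w hv hw φ hφ
    have h1 : ∫ x in Ω, (v.fst + w.fst : Lp ℝ 2 (volume.restrict Ω)) x • ∇ φ x
        = (∫ x in Ω, v.fst x • ∇ φ x) + ∫ x in Ω, w.fst x • ∇ φ x := by
      rw [← integral_add (hφ.integrable_smul_gradient _) (hφ.integrable_smul_gradient _)]
      refine integral_congr_ae ?_
      filter_upwards [Lp.coeFn_add v.fst w.fst] with x hx
      rw [hx, Pi.add_apply, add_smul]
    have h2 : ∫ x in Ω, φ x •
          (v.snd + w.snd : Lp (EuclideanSpace ℝ (Fin d)) 2 (volume.restrict Ω)) x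
        = (∫ x in Ω, φ x • v.snd x) + ∫ x in Ω, φ x • w.snd x := by
      rw [← integral_add (hφ.integrable_smul _) (hφ.integrable_smul _)]
      refine integral_congr_ae ?_
      filter_upwards [Lp.coeFn_add v.snd w.snd] with x hx
      rw [hx, Pi.add_apply, smul_add]
    simp only [WithLp.add_fst, WithLp.add_snd]
    rw [h1, h2, hv φ hφ, hw φ hφ, neg_add]
  smul_mem' := by
    intro c w hw φ hφ
    have h1 : ∫ x in Ω, (c • w.fst : Lp ℝ 2 (volume.restrict Ω)) x • ∇ φ x
        = c • ∫ x in Ω, w.fst x • ∇ φ x := by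
      rw [← integral_smul]
      refine integral_congr_ae ?_
      filter_upwards [Lp.coeFn_smul c w.fst] with x hx
      rw [hx, Pi.smul_apply, smul_assoc]
    have h2 : ∫ x in Ω, φ x •
          (c • w.snd : Lp (EuclideanSpace ℝ (Fin d)) 2 (volume.restrict Ω)) x
        = c • ∫ x in Ω, φ x • w.snd x := by
      rw [← integral_smul]
      refine integral_congr_ae ?_
      filter_upwards [Lp.coeFn_smul c w.snd] with x hx
      rw [hx, Pi.smul_apply, smul_comm c]
    simp only [WithLp.smul_fst, WithLp.smul_snd]
    rw [h1, h2, hw φ hφ, smul_neg]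

/-- The weak gradient of an element of `H¹(Ω)`. -/
def H1.grad {d : ℕ} {Ω : Set (EuclideanSpace ℝ (Fin d))} (u : H1 Ω) :
    Lp (EuclideanSpace ℝ (Fin d)) 2 (volume.restrict Ω) :=
  (u : WithLp 2
    (Lp ℝ 2 (volume.restrict Ω) × Lp (EuclideanSpace ℝ (Fin d)) 2 (volume.restrict Ω))).snd

/-- The function underlying an element of `H¹(Ω)`. -/
def H1.toL2 {d : ℕ} {Ω : Set (EuclideanSpace ℝ (Fin d))} (u : H1 Ω) :
    Lp ℝ 2 (volume.restrict Ω) :=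
  (u : WithLp 2
    (Lp ℝ 2 (volume.restrict Ω) × Lp (EuclideanSpace ℝ (Fin d)) 2 (volume.restrict Ω))).fst

/-- `H¹₀(Ω)`, the closure of `C_c^∞(Ω)` in `H¹(Ω)`. -/
def H10 {d : ℕ} (Ω : Set (EuclideanSpace ℝ (Fin d))) : Submodule ℝ (H1 Ω) :=
  (Submodule.span ℝ {u : H1 Ω | ∃ φ : EuclideanSpace ℝ (Fin d) → ℝ, IsTestFunction Ω φ ∧
    H1.toL2 u =ᵐ[volume.restrict Ω] φ ∧
    H1.grad u =ᵐ[volume.restrict Ω] (fun x => ∇ φ x)}).topologicalClosure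

/-- `H^{1/2}(∂Ω)`, the space of boundary values of functions in `H¹(Ω)`, realised as the
quotient `H¹(Ω) / H¹₀(Ω)`. -/
abbrev HHalf {d : ℕ} (Ω : Set (EuclideanSpace ℝ (Fin d))) : Type :=
  H1 Ω ⧸ H10 Ω

/-- The boundary value in `H^{1/2}(∂Ω)` of a function in `H¹(Ω)`. -/
def H1.boundaryValue {d : ℕ} {Ω : Set (EuclideanSpace ℝ (Fin d))} (u : H1 Ω) : HHalf Ω :=
  (H10 Ω).mkQ u

/-- `H^{-1/2}(∂Ω)`, the topological dual of `H^{1/2}(∂Ω)`. -/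
abbrev HNegHalf {d : ℕ} (Ω : Set (EuclideanSpace ℝ (Fin d))) : Type :=
  StrongDual ℝ (HHalf Ω)

/-- `u ∈ H¹(Ω)` is a weak solution of `div (γ ∇u) = 0` in `Ω`. -/
def IsConductivitySolution {d : ℕ} {Ω : Set (EuclideanSpace ℝ (Fin d))}
    (γ : EuclideanSpace ℝ (Fin d) → ℝ) (u : H1 Ω) : Prop :=
  ∀ φ : EuclideanSpace ℝ (Fin d) → ℝ, IsTestFunction Ω φ →
    ∫ x in Ω, γ x * ⟪H1.grad u x, ∇ φ x⟫ = 0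

/-- `Λ ∈ H^{-1/2}(∂Ω)` is the conormal derivative `γ ∂u/∂η` on `∂Ω`, defined weakly by
`⟨Λ, v|_∂Ω⟩ = ∫_Ω γ ∇u · ∇v` for all `v ∈ H¹(Ω)`. -/
def IsConormalDerivative {d : ℕ} {Ω : Set (EuclideanSpace ℝ (Fin d))}
    (γ : EuclideanSpace ℝ (Fin d) → ℝ) (u : H1 Ω) (Λ : HNegHalf Ω) : Prop :=
  ∀ v : H1 Ω, Λ (H1.boundaryValue v) = ∫ x in Ω, γ x * ⟪H1.grad u x, H1.grad v x⟫

open Classical in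
/-- The Dirichlet-to-Neumann map `H^{1/2}(∂Ω) → H^{-1/2}(∂Ω)`, sending `f` to `γ ∂u/∂η` where
`u ∈ H¹(Ω)` solves `div (γ ∇u) = 0` in `Ω` and `u = f` on `∂Ω`. For `Ω` bounded and `γ` measurable,
bounded, and bounded below by a positive constant there is exactly one such `u`, and exactly one
such functional; the alternative value `0` is never taken there. -/
def DtN {d : ℕ} (Ω : Set (EuclideanSpace ℝ (Fin d))) (γ : EuclideanSpace ℝ (Fin d) → ℝ)
    (f : HHalf Ω) : HNegHalf Ω :=
  if h : ∃ Λ : HNegHalf Ω, ∃ u : H1 Ω,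
      H1.boundaryValue u = f ∧ IsConductivitySolution γ u ∧ IsConormalDerivative γ u Λ
  then h.choose else 0

/-- `a` is the boundary value (trace) of `u` at `z ∈ ∂Ω`: the mean of `|u - a|` over
`B(z, r) ∩ Ω` tends to `0` as `r → 0`. -/
def HasBoundaryValueAt {d : ℕ} (Ω : Set (EuclideanSpace ℝ (Fin d)))
    (u : EuclideanSpace ℝ (Fin d) → ℝ) (z : EuclideanSpace ℝ (Fin d)) (a : ℝ) : Prop :=
  Tendsto (fun r : ℝ => ⨍ x in ball z r ∩ Ω, |u x - a|) (𝓝[>] 0) (𝓝 0)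

end

/-! ### Integration by parts and the Poincaré inequality for smooth functions. -/

section SmoothFunctions

variable {E : Type*} [NormedAddCommGroup E] [InnerProductSpace ℝ E] [FiniteDimensional ℝ E]

/-! The theorem combines an energy comparison, which orders boundary values wherever they exist,
with the existence of boundary values almost everywhere.

Comparison. Fix boundary data given by a smooth `V`. The number `⟨DtN f, f⟩` is the minimum of `∫ γ₁
|∇V|²` over extensions (Dirichlet principle) and the maximum of `2 ∫ T · ∇V - ∫ γ₂⁻¹ |T|²` over
divergence free fields `T` (Thomson principle). If the two maps agree, every dual energy for `γ₂` is
therefore at most every energy for `γ₁`; this is `dual_energy_le_energy`. Divergence free fields are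
supplied by rotating a gradient in a plane.

Now concentrate `V` and `T` at a boundary point `z`. Since `Ω` is `C¹`, its blow-ups at `z` tend to
a half-space `{⟪n, y⟫ > 0}`, and if `γ₁`, `γ₂` have boundary values `a₁`, `a₂` at `z`, only these
constants survive in the limit. Taking `T` to be `a₂` times the rotated gradient of `W`, one obtains
`a₂ (‖∇V‖² - ‖∇V - rot W‖²) ≤ a₁ ‖∇V‖²` in `L²` of the half-space
(`boundaryValue_mul_dual_energy_le`). For a unit vector `b` orthogonal to `n`, the functions `exp
(-⟪n, y⟫) cos ⟪b, y⟫` and `exp (-⟪n, y⟫) sin ⟪b, y⟫` are harmonic conjugates, so the gradient of the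
first is the rotated gradient of the second. Cut-offs at a suitable large radius make the relative
error as small as desired (`exists_almost_conjugate`), whence `a₂ ≤ a₁`. Exchanging the
conductivities gives equality.

Traces. In graph coordinates a `W^{1,1}` function minus the vertical primitive of its vertical
derivative is constant on almost every fibre (`ae_sub_eq_setIntegral_of_weak_lineDeriv`,
`exists_fibre_trace`). That constant is the trace, and at Lebesgue points of the base it is the
limit of means over cylinders, hence over half balls (`tendsto_average_abs_sub_fibre_trace`). The
graph parametrisation is locally Lipschitz, so exceptional sets in the base become null for the
Hausdorff measure on the boundary (`MemW11.ae_exists_hasBoundaryValueAt`). Beyond integrability, the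
Sobolev hypothesis serves only here. -/

lemma ContDiff.continuous_gradient {V : E → ℝ} {n : WithTop ℕ∞} (hV : ContDiff ℝ n V)
    (hn : n ≠ 0) : Continuous (∇ V) :=
  (InnerProductSpace.toDual ℝ E).symm.continuous.comp (hV.continuous_fderiv hn)

lemma HasCompactSupport.gradient {V : E → ℝ} (hc : HasCompactSupport V) :
    HasCompactSupport (∇ V) :=
  (hc.fderiv ℝ).comp_left (g := (InnerProductSpace.toDual ℝ E).symm) (map_zero _)

lemma gradient_eq_zero_of_notMem_tsupport {V : E → ℝ} {x : E} (hx : x ∉ tsupport V) :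
    ∇ V x = 0 := by
  have h : fderiv ℝ V x = 0 := by
    by_contra h
    exact hx (support_fderiv_subset ℝ h)
  rw [gradient, h, map_zero]

variable [MeasurableSpace E] [BorelSpace E] {μ : Measure E} [μ.IsAddHaarMeasure]

/-- Integration by parts in the direction `c`, one of the functions having compact support. -/
lemma integral_mul_inner_gradient {V φ : E → ℝ} (hV : ContDiff ℝ 1 V) (hφ : ContDiff ℝ 1 φ)
    (hc : HasCompactSupport φ) (c : E) :
    ∫ x, V x * ⟪∇ φ x, c⟫ ∂μ = -∫ x, ⟪∇ V x, c⟫ * φ x ∂μ := by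
  have hVc := hV.continuous
  have hφc := hφ.continuous
  have hV' := hV.continuous_gradient one_ne_zero
  have hφ' := hφ.continuous_gradient one_ne_zero
  simp only [inner_gradient_left]
  refine integral_mul_fderiv_eq_neg_fderiv_mul_of_integrable ?_ ?_ ?_
    (fun x _ => (hV.differentiable one_ne_zero) x) (fun x _ => (hφ.differentiable one_ne_zero) x)
  · simp only [← inner_gradient_left]
    exact Continuous.integrable_of_hasCompactSupport (by fun_prop) hc.mul_left
  · simp only [← inner_gradient_left]
    refine Continuous.integrable_of_hasCompactSupport (by fun_prop) ?_
    exact HasCompactSupport.mul_left (hc.gradient.comp_left (g := fun y => ⟪y, c⟫) (by simp))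
  · exact Continuous.integrable_of_hasCompactSupport (by fun_prop) hc.mul_left

lemma integral_smul_gradient {V φ : E → ℝ} (hV : ContDiff ℝ 1 V) (hφ : ContDiff ℝ 1 φ)
    (hc : HasCompactSupport φ) : ∫ x, V x • ∇ φ x ∂μ = -∫ x, φ x • ∇ V x ∂μ := by
  have hVc := hV.continuous
  have hφc := hφ.continuous
  have hV' := hV.continuous_gradient one_ne_zero
  have hφ' := hφ.continuous_gradient one_ne_zero
  have h1 : Integrable (fun x => V x • ∇ φ x) μ :=
    Continuous.integrable_of_hasCompactSupport (by fun_prop) hc.gradient.smul_left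
  have h2 : Integrable (fun x => φ x • ∇ V x) μ :=
    Continuous.integrable_of_hasCompactSupport (by fun_prop) hc.smul_right
  refine ext_inner_left ℝ fun c => ?_
  rw [inner_neg_right, ← integral_inner h1, ← integral_inner h2]
  have h := integral_mul_inner_gradient (μ := μ) hV hφ hc c
  simp only [inner_smul_right, mul_comm (φ _)]
  simpa only [real_inner_comm c] using h

/-- Poincaré inequality for functions supported in the ball of radius `R` about the origin. -/
lemma integral_sq_le_integral_gradient_sq [Nontrivial E] {φ : E → ℝ} (hφ : ContDiff ℝ 1 φ)
    (hc : HasCompactSupport φ) {R : ℝ} (hR : ∀ x ∈ tsupport φ, ‖x‖ ≤ R) :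
    ∫ x, φ x ^ 2 ∂μ ≤ 4 * R ^ 2 * ∫ x, ‖∇ φ x‖ ^ 2 ∂μ := by
  obtain ⟨e, he⟩ := exists_norm_eq E zero_le_one
  have hφc := hφ.continuous
  have hφ' := hφ.continuous_gradient one_ne_zero
  have hlin : ContDiff ℝ 1 (fun x : E => ⟪e, x⟫) := contDiff_const.inner ℝ contDiff_id
  have hsq : ContDiff ℝ 1 (fun x : E => φ x ^ 2) := by fun_prop
  have hsqc : HasCompactSupport (fun x : E => φ x ^ 2) :=
    hc.comp_left (g := fun y => y ^ 2) (by simp)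
  -- The linear function `⟪e, x⟫` has derivative `1` in the direction `e`, so integrating by parts
  -- against `φ ^ 2` expresses `∫ φ ^ 2` through `φ` and `∇ φ`.
  have key := integral_mul_inner_gradient (μ := μ) hlin hsq hsqc e
  have g1 : ∀ x, ⟪∇ (fun x : E => φ x ^ 2) x, e⟫ = 2 * φ x * ⟪∇ φ x, e⟫ := by
    intro x
    have h := ((hφ.differentiable one_ne_zero x).hasFDerivAt.pow 2).fderiv
    rw [inner_gradient_left, inner_gradient_left]
    simp only [h]
    simp
  have g2 : ∀ x, ⟪∇ (fun x : E => ⟪e, x⟫) x, e⟫ = 1 := by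
    intro x
    rw [inner_gradient_left]
    have h : HasFDerivAt (fun x : E => ⟪e, x⟫) (innerSL ℝ e) x := (innerSL ℝ e).hasFDerivAt
    rw [h.fderiv]
    simp [he]
  simp only [g1, g2, one_mul] at key
  have i1 : Integrable (fun x => φ x ^ 2) μ :=
    Continuous.integrable_of_hasCompactSupport (by fun_prop) hsqc
  have i2 : Integrable (fun x => ‖∇ φ x‖ ^ 2) μ :=
    Continuous.integrable_of_hasCompactSupport (by fun_prop)
      (hc.gradient.comp_left (g := fun y => ‖y‖ ^ 2) (by simp))
  have i3 : Integrable (fun x => ⟪e, x⟫ * (2 * φ x * ⟪∇ φ x, e⟫)) μ :=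
    Continuous.integrable_of_hasCompactSupport (by fun_prop)
      ((hc.mul_left (f := fun _ => (2 : ℝ))).mul_right.mul_left)
  -- Young's inequality. Half of `φ ^ 2` is absorbed by the left side afterwards, which turns `2 * R
  -- ^ 2` into the constant `4 * R ^ 2`.
  have hpt : ∀ x, -(⟪e, x⟫ * (2 * φ x * ⟪∇ φ x, e⟫)) ≤
      φ x ^ 2 / 2 + 2 * R ^ 2 * ‖∇ φ x‖ ^ 2 := by
    intro x
    by_cases hx : x ∈ tsupport φ
    · have h1 : |⟪e, x⟫| ≤ R := (abs_real_inner_le_norm e x).trans (by simpa [he] using hR x hx)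
      have h2 : |⟪∇ φ x, e⟫| ≤ ‖∇ φ x‖ := (abs_real_inner_le_norm _ e).trans (by simp [he])
      have h3 : |⟪e, x⟫ * ⟪∇ φ x, e⟫| ≤ R * ‖∇ φ x‖ := by
        rw [abs_mul]
        exact mul_le_mul h1 h2 (abs_nonneg _) ((abs_nonneg _).trans h1)
      have h4 : (⟪e, x⟫ * ⟪∇ φ x, e⟫) ^ 2 ≤ (R * ‖∇ φ x‖) ^ 2 := sq_le_sq' (abs_le.1 h3).1 (abs_le.1 h3).2
      nlinarith [sq_nonneg (φ x + 2 * (⟪e, x⟫ * ⟪∇ φ x, e⟫))]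
    · rw [image_eq_zero_of_notMem_tsupport hx]
      simp only [mul_zero, zero_mul, neg_zero]
      positivity
  have hint : ∫ x, φ x ^ 2 ∂μ ≤ ∫ x, (φ x ^ 2 / 2 + 2 * R ^ 2 * ‖∇ φ x‖ ^ 2) ∂μ := by
    rw [← neg_eq_iff_eq_neg.2 key, ← integral_neg]
    exact integral_mono i3.neg ((i1.div_const 2).add (i2.const_mul _)) hpt
  rw [integral_add (i1.div_const 2) (i2.const_mul _), integral_div, integral_const_mul] at hint
  linarith

end SmoothFunctions

/-! ### The Hilbert space `H¹(Ω)` and its subspace `H¹₀(Ω)`. -/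

section SobolevSpace

variable {d : ℕ} {Ω : Set (EuclideanSpace ℝ (Fin d))}

lemma IsTestFunction.contDiff_one {φ : EuclideanSpace ℝ (Fin d) → ℝ} (hφ : IsTestFunction Ω φ) :
    ContDiff ℝ 1 φ := hφ.smooth.of_le (by simp)

lemma IsTestFunction.setIntegral_smul_gradient {V φ : EuclideanSpace ℝ (Fin d) → ℝ}
    (hφ : IsTestFunction Ω φ) (hV : ContDiff ℝ 1 V) :
    ∫ x in Ω, V x • ∇ φ x = -∫ x in Ω, φ x • ∇ V x := by
  rw [setIntegral_eq_integral_of_forall_compl_eq_zero, setIntegral_eq_integral_of_forall_compl_eq_zero]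
  · exact integral_smul_gradient hV hφ.contDiff_one hφ.hasCompactSupport
  · intro x hx
    rw [image_eq_zero_of_notMem_tsupport (fun h => hx (hφ.tsupport_subset h)), zero_smul]
  · intro x hx
    rw [gradient_eq_zero_of_notMem_tsupport (fun h => hx (hφ.tsupport_subset h)), smul_zero]

/-- The element of `H¹(Ω)` given by the restriction of a smooth compactly supported function. -/
noncomputable def H1.ofSmooth (Ω : Set (EuclideanSpace ℝ (Fin d)))
    {V : EuclideanSpace ℝ (Fin d) → ℝ} (hV : ContDiff ℝ ∞ V) (hc : HasCompactSupport V) : H1 Ω :=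
  ⟨WithLp.toLp 2
    (MemLp.toLp V (hV.continuous.memLp_of_hasCompactSupport hc),
      MemLp.toLp (∇ V) ((hV.continuous_gradient (by simp)).memLp_of_hasCompactSupport hc.gradient)),
    fun φ hφ => by
      have h1 : ∫ x in Ω, (MemLp.toLp V (hV.continuous.memLp_of_hasCompactSupport hc) :
          Lp ℝ 2 (volume.restrict Ω)) x • ∇ φ x = ∫ x in Ω, V x • ∇ φ x := by
        refine integral_congr_ae ?_
        filter_upwards [MemLp.coeFn_toLp (hV.continuous.memLp_of_hasCompactSupport (p := 2)
          (μ := volume.restrict Ω) hc)] with x hx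
        rw [hx]
      have h2 : ∫ x in Ω, φ x • (MemLp.toLp (∇ V)
          ((hV.continuous_gradient (by simp)).memLp_of_hasCompactSupport hc.gradient) :
          Lp (EuclideanSpace ℝ (Fin d)) 2 (volume.restrict Ω)) x = ∫ x in Ω, φ x • ∇ V x := by
        refine integral_congr_ae ?_
        filter_upwards [MemLp.coeFn_toLp ((hV.continuous_gradient (by simp)).memLp_of_hasCompactSupport
          (p := 2) (μ := volume.restrict Ω) hc.gradient)] with x hx
        rw [hx]
      refine h1.trans ((hφ.setIntegral_smul_gradient (hV.of_le (by simp))).trans ?_)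
      exact congrArg Neg.neg h2.symm⟩

lemma H1.toL2_ofSmooth {V : EuclideanSpace ℝ (Fin d) → ℝ} (hV : ContDiff ℝ ∞ V)
    (hc : HasCompactSupport V) : H1.toL2 (H1.ofSmooth Ω hV hc) =ᵐ[volume.restrict Ω] V :=
  MemLp.coeFn_toLp (hV.continuous.memLp_of_hasCompactSupport hc)

lemma H1.grad_ofSmooth {V : EuclideanSpace ℝ (Fin d) → ℝ} (hV : ContDiff ℝ ∞ V)
    (hc : HasCompactSupport V) : H1.grad (H1.ofSmooth Ω hV hc) =ᵐ[volume.restrict Ω] ∇ V :=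
  MemLp.coeFn_toLp ((hV.continuous_gradient (by simp)).memLp_of_hasCompactSupport hc.gradient)

lemma IsTestFunction.memLp_smul_const {φ : EuclideanSpace ℝ (Fin d) → ℝ} (hφ : IsTestFunction Ω φ)
    (c : EuclideanSpace ℝ (Fin d)) : MemLp (fun x => φ x • c) 2 (volume.restrict Ω) :=
  (hφ.smooth.continuous.smul continuous_const).memLp_of_hasCompactSupport
    (hφ.hasCompactSupport.smul_right)

lemma IsTestFunction.memLp_inner_gradient {φ : EuclideanSpace ℝ (Fin d) → ℝ}
    (hφ : IsTestFunction Ω φ) (c : EuclideanSpace ℝ (Fin d)) :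
    MemLp (fun x => ⟪∇ φ x, c⟫) 2 (volume.restrict Ω) :=
  ((hφ.smooth.continuous_gradient (by simp)).memLp_of_hasCompactSupport
    hφ.hasCompactSupport.gradient).inner_const c

/-- The weak gradient identity, tested with `φ` and paired with a vector `c`, says that `(u, G)` is
orthogonal in `L² × L²` to the pair `(∂_c φ, φ c)`. Hence `H¹(Ω)` is an intersection of closed
hyperplanes; its completeness is needed for Lax–Milgram. -/
lemma isClosed_H1 : IsClosed (H1 Ω : Set (WithLp 2
    (Lp ℝ 2 (volume.restrict Ω) × Lp (EuclideanSpace ℝ (Fin d)) 2 (volume.restrict Ω)))) := by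
  have h : (H1 Ω : Set (WithLp 2
      (Lp ℝ 2 (volume.restrict Ω) × Lp (EuclideanSpace ℝ (Fin d)) 2 (volume.restrict Ω)))) =
      ⋂ (φ : EuclideanSpace ℝ (Fin d) → ℝ) (hφ : IsTestFunction Ω φ)
        (c : EuclideanSpace ℝ (Fin d)), {w | ⟪(WithLp.toLp 2 ((hφ.memLp_inner_gradient c).toLp _,
          (hφ.memLp_smul_const c).toLp _) : WithLp 2 (Lp ℝ 2 (volume.restrict Ω) ×
            Lp (EuclideanSpace ℝ (Fin d)) 2 (volume.restrict Ω))), w⟫ = 0} := by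
    ext w
    have hw : w ∈ H1 Ω ↔ IsWeakGradient Ω w.fst w.snd := Iff.rfl
    simp only [SetLike.mem_coe, hw, IsWeakGradient, Set.mem_iInter, Set.mem_ofPred_eq]
    refine forall_congr' fun φ => forall_congr' fun hφ => ?_
    have hcalc : ∀ c, ⟪(WithLp.toLp 2 ((hφ.memLp_inner_gradient c).toLp _,
          (hφ.memLp_smul_const c).toLp _) : WithLp 2 (Lp ℝ 2 (volume.restrict Ω) ×
            Lp (EuclideanSpace ℝ (Fin d)) 2 (volume.restrict Ω))), w⟫ =
          ⟪c, (∫ x in Ω, w.fst x • ∇ φ x) + ∫ x in Ω, φ x • w.snd x⟫ := by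
      intro c
      rw [WithLp.prod_inner_apply, L2.inner_def, L2.inner_def, inner_add_right,
        ← integral_inner (hφ.integrable_smul_gradient _), ← integral_inner (hφ.integrable_smul _)]
      congr 1
      · refine integral_congr_ae ?_
        filter_upwards [(hφ.memLp_inner_gradient c).coeFn_toLp] with x hx
        simp only [WithLp.fst]
        rw [hx, inner_smul_right, real_inner_comm]
        simp [mul_comm]
      · refine integral_congr_ae ?_
        filter_upwards [(hφ.memLp_smul_const c).coeFn_toLp] with x hx
        simp only [WithLp.snd]
        rw [hx, inner_smul_right, real_inner_smul_left]
    simp only [hcalc]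
    rw [eq_neg_iff_add_eq_zero]
    exact ⟨fun h c => by rw [h, inner_zero_right], fun h => ext_inner_left ℝ fun c => by
      rw [h c, inner_zero_right]⟩
  rw [h]
  refine isClosed_iInter fun φ => isClosed_iInter fun hφ => isClosed_iInter fun c => ?_
  exact isClosed_eq (by fun_prop) continuous_const

instance : CompleteSpace (H1 Ω) := isClosed_H1.completeSpace_coe

/-- The weak gradient as a continuous linear map. -/
noncomputable def H1.gradL (Ω : Set (EuclideanSpace ℝ (Fin d))) :
    H1 Ω →L[ℝ] Lp (EuclideanSpace ℝ (Fin d)) 2 (volume.restrict Ω) :=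
  (WithLp.sndL 2 ℝ _ _).comp (H1 Ω).subtypeL

/-- The inclusion of `H¹(Ω)` in `L²(Ω)` as a continuous linear map. -/
noncomputable def H1.toL2L (Ω : Set (EuclideanSpace ℝ (Fin d))) :
    H1 Ω →L[ℝ] Lp ℝ 2 (volume.restrict Ω) :=
  (WithLp.fstL 2 ℝ _ _).comp (H1 Ω).subtypeL

lemma H1.gradL_apply (u : H1 Ω) : H1.gradL Ω u = H1.grad u := rfl

lemma H1.toL2L_apply (u : H1 Ω) : H1.toL2L Ω u = H1.toL2 u := rfl

lemma H1.norm_sq (u : H1 Ω) : ‖u‖ ^ 2 = ‖H1.toL2 u‖ ^ 2 + ‖H1.grad u‖ ^ 2 :=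
  WithLp.prod_norm_sq_eq_of_L2 _

/-- A closed condition on `H¹(Ω)` that holds for test functions holds on `H¹₀(Ω)`. -/
lemma H10.induction {p : H1 Ω → Prop} (hp : IsClosed {u | p u})
    (h : ∀ (u : H1 Ω) (φ : EuclideanSpace ℝ (Fin d) → ℝ), IsTestFunction Ω φ →
      H1.toL2 u =ᵐ[volume.restrict Ω] φ →
      H1.grad u =ᵐ[volume.restrict Ω] (fun x => ∇ φ x) → p u)
    {u : H1 Ω} (hu : u ∈ H10 Ω) : p u := by
  have hspan : ((Submodule.span ℝ {u : H1 Ω | ∃ φ : EuclideanSpace ℝ (Fin d) → ℝ,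
      IsTestFunction Ω φ ∧ H1.toL2 u =ᵐ[volume.restrict Ω] φ ∧
      H1.grad u =ᵐ[volume.restrict Ω] (fun x => ∇ φ x)} : Submodule ℝ (H1 Ω)) : Set (H1 Ω)) ⊆
      {u | p u} := by
    intro u hu
    -- Elements represented by test functions already form a subspace, so taking the span adds
    -- nothing and only the closure matters.
    suffices h' : ∃ φ : EuclideanSpace ℝ (Fin d) → ℝ,
      IsTestFunction Ω φ ∧ H1.toL2 u =ᵐ[volume.restrict Ω] φ ∧
      H1.grad u =ᵐ[volume.restrict Ω] (fun x => ∇ φ x) by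
      obtain ⟨φ, h1, h2, h3⟩ := h'
      exact h u φ h1 h2 h3
    induction hu using Submodule.span_induction with
    | mem u hu => exact hu
    | zero =>
      refine ⟨0, ⟨contDiff_const, HasCompactSupport.zero, by simp⟩, Lp.coeFn_zero _ _ _, ?_⟩
      filter_upwards [Lp.coeFn_zero (EuclideanSpace ℝ (Fin d)) 2 (volume.restrict Ω)] with x hx
      refine hx.trans ?_
      simp [gradient]
    | add u v _ _ hu hv =>
      obtain ⟨φ, hφ, h1, h2⟩ := hu
      obtain ⟨χ, hχ, k1, k2⟩ := hv
      refine ⟨φ + χ, ⟨hφ.smooth.add hχ.smooth, hφ.hasCompactSupport.add hχ.hasCompactSupport,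
        (tsupport_add φ χ).trans (Set.union_subset hφ.tsupport_subset hχ.tsupport_subset)⟩, ?_, ?_⟩
      · filter_upwards [Lp.coeFn_add (H1.toL2 u) (H1.toL2 v), h1, k1] with x hx ha hb
        exact hx.trans (by simp [ha, hb])
      · filter_upwards [Lp.coeFn_add (H1.grad u) (H1.grad v), h2, k2] with x hx ha hb
        refine hx.trans ?_
        rw [Pi.add_apply, ha, hb, gradient, gradient, gradient, fderiv_add
          (hφ.smooth.differentiable (by simp) x) (hχ.smooth.differentiable (by simp) x), map_add]
    | smul c u _ hu =>
      obtain ⟨φ, hφ, h1, h2⟩ := hu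
      refine ⟨c • φ, ⟨hφ.smooth.const_smul c, hφ.hasCompactSupport.smul_left,
        (closure_mono (Function.support_const_smul_subset c φ)).trans hφ.tsupport_subset⟩, ?_, ?_⟩
      · filter_upwards [Lp.coeFn_smul c (H1.toL2 u), h1] with x hx ha
        exact hx.trans (by simp [ha])
      · filter_upwards [Lp.coeFn_smul c (H1.grad u), h2] with x hx ha
        refine hx.trans ?_
        rw [Pi.smul_apply, ha, gradient, gradient, fderiv_const_smul
          (hφ.smooth.differentiable (by simp) x), map_smul]
  exact closure_minimal hspan hp hu

lemma Lp.norm_sq_eq_integral {α F : Type*} [MeasurableSpace α] {μ : Measure α}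
    [NormedAddCommGroup F] [InnerProductSpace ℝ F] (f : Lp F 2 μ) :
    ‖f‖ ^ 2 = ∫ x, ‖f x‖ ^ 2 ∂μ := by
  rw [← real_inner_self_eq_norm_sq, L2.inner_def]
  simp

/-- Poincaré inequality on `H¹₀(Ω)`. -/
lemma H10.exists_norm_toL2_le (hd : 2 ≤ d) (hbdd : Bornology.IsBounded Ω) :
    ∃ C : ℝ, ∀ u ∈ H10 Ω, ‖H1.toL2 u‖ ^ 2 ≤ C * ‖H1.grad u‖ ^ 2 := by
  obtain ⟨R, hR⟩ := hbdd.exists_norm_le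
  have : Nonempty (Fin d) := ⟨⟨0, by omega⟩⟩
  refine ⟨4 * R ^ 2, fun u hu => ?_⟩
  refine H10.induction (p := fun u => ‖H1.toL2 u‖ ^ 2 ≤ 4 * R ^ 2 * ‖H1.grad u‖ ^ 2) ?_ ?_ hu
  · simp only [← H1.gradL_apply, ← H1.toL2L_apply]
    exact isClosed_le (by fun_prop) (by fun_prop)
  · intro u φ hφ h1 h2
    have k1 : ‖H1.toL2 u‖ ^ 2 = ∫ x, φ x ^ 2 := by
      rw [Lp.norm_sq_eq_integral, ← setIntegral_eq_integral_of_forall_compl_eq_zero (s := Ω)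
        (μ := volume) (f := fun x => φ x ^ 2)]
      · refine integral_congr_ae ?_
        filter_upwards [h1] with x hx
        simp [hx]
      · intro x hx
        rw [image_eq_zero_of_notMem_tsupport (fun h => hx (hφ.tsupport_subset h))]
        simp
    have k2 : ‖H1.grad u‖ ^ 2 = ∫ x, ‖∇ φ x‖ ^ 2 := by
      rw [Lp.norm_sq_eq_integral, ← setIntegral_eq_integral_of_forall_compl_eq_zero (s := Ω)
        (μ := volume) (f := fun x => ‖∇ φ x‖ ^ 2)]
      · refine integral_congr_ae ?_
        filter_upwards [h2] with x hx
        simp [hx]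
      · intro x hx
        rw [gradient_eq_zero_of_notMem_tsupport (fun h => hx (hφ.tsupport_subset h))]
        simp
    rw [k1, k2]
    exact integral_sq_le_integral_gradient_sq hφ.contDiff_one hφ.hasCompactSupport
      fun x hx => hR x (hφ.tsupport_subset hx)

end SobolevSpace

/-! ### Solvability of the Dirichlet problem and the two energy principles. -/

section ConductivityForm

lemma memLp_smul_of_ae_norm_le {α F : Type*} [MeasurableSpace α] {μ : Measure α}
    [NormedAddCommGroup F] [InnerProductSpace ℝ F] {γ : α → ℝ} {l : ℝ}
    (hγ : AEStronglyMeasurable γ μ) (hl : ∀ᵐ x ∂μ, ‖γ x‖ ≤ l) {f : α → F} (hf : MemLp f 2 μ) :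
    MemLp (fun x => γ x • f x) 2 μ := by
  refine hf.of_le_mul (c := l) (hγ.smul hf.aestronglyMeasurable) ?_
  filter_upwards [hl] with x hx
  rw [norm_smul]
  gcongr

/-- Multiplication by a bounded measurable function on `L²`. -/
noncomputable def Lp.mulBounded {α F : Type*} [MeasurableSpace α] {μ : Measure α}
    [NormedAddCommGroup F] [InnerProductSpace ℝ F] {γ : α → ℝ} {l : ℝ}
    (hγ : AEStronglyMeasurable γ μ) (hl : ∀ᵐ x ∂μ, ‖γ x‖ ≤ l) : Lp F 2 μ →L[ℝ] Lp F 2 μ :=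
  LinearMap.mkContinuous
    { toFun := fun f => (memLp_smul_of_ae_norm_le hγ hl (Lp.memLp f)).toLp _
      map_add' := fun f g => by
        rw [← MemLp.toLp_add, MemLp.toLp_eq_toLp_iff]
        filter_upwards [Lp.coeFn_add f g] with x hx
        simp only [hx, Pi.add_apply, smul_add]
      map_smul' := fun c f => by
        rw [RingHom.id_apply, ← MemLp.toLp_const_smul, MemLp.toLp_eq_toLp_iff]
        filter_upwards [Lp.coeFn_smul c f] with x hx
        simp only [hx, Pi.smul_apply, smul_comm c] }
    l (fun f => by
      refine Lp.norm_le_mul_norm_of_ae_le_mul ?_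
      filter_upwards [hl, (memLp_smul_of_ae_norm_le hγ hl (Lp.memLp f)).coeFn_toLp] with x hx hx'
      simp only [LinearMap.coe_mk, AddHom.coe_mk]
      rw [hx', norm_smul]
      gcongr)

lemma Lp.coeFn_mulBounded {α F : Type*} [MeasurableSpace α] {μ : Measure α}
    [NormedAddCommGroup F] [InnerProductSpace ℝ F] {γ : α → ℝ} {l : ℝ}
    (hγ : AEStronglyMeasurable γ μ) (hl : ∀ᵐ x ∂μ, ‖γ x‖ ≤ l) (f : Lp F 2 μ) :
    Lp.mulBounded hγ hl f =ᵐ[μ] fun x => γ x • f x :=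
  (memLp_smul_of_ae_norm_le hγ hl (Lp.memLp f)).coeFn_toLp

lemma Lp.inner_mulBounded {α F : Type*} [MeasurableSpace α] {μ : Measure α}
    [NormedAddCommGroup F] [InnerProductSpace ℝ F] {γ : α → ℝ} {l : ℝ}
    (hγ : AEStronglyMeasurable γ μ) (hl : ∀ᵐ x ∂μ, ‖γ x‖ ≤ l) (f g : Lp F 2 μ) :
    ⟪Lp.mulBounded hγ hl f, g⟫ = ∫ x, γ x * ⟪f x, g x⟫ ∂μ := by
  rw [L2.inner_def]
  refine integral_congr_ae ?_
  filter_upwards [Lp.coeFn_mulBounded hγ hl f] with x hx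
  rw [hx, real_inner_smul_left]

lemma Lp.integrable_mul_inner {α F : Type*} [MeasurableSpace α] {μ : Measure α}
    [NormedAddCommGroup F] [InnerProductSpace ℝ F] {γ : α → ℝ} {l : ℝ}
    (hγ : AEStronglyMeasurable γ μ) (hl : ∀ᵐ x ∂μ, ‖γ x‖ ≤ l) (f g : Lp F 2 μ) :
    Integrable (fun x => γ x * ⟪f x, g x⟫) μ :=
  (L2.integrable_inner f g).bdd_mul hγ hl

variable {d : ℕ} {Ω : Set (EuclideanSpace ℝ (Fin d))}

/-- A measurable conductivity that is bounded above and below by positive constants. -/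
structure IsElliptic (Ω : Set (EuclideanSpace ℝ (Fin d))) (γ : EuclideanSpace ℝ (Fin d) → ℝ)
    (l : ℝ) : Prop where
  aestronglyMeasurable : AEStronglyMeasurable γ (volume.restrict Ω)
  pos : 0 < l
  bounds : ∀ᵐ x ∂(volume.restrict Ω), 1 / l ≤ γ x ∧ γ x ≤ l

lemma IsElliptic.ae_norm_le {γ : EuclideanSpace ℝ (Fin d) → ℝ} {l : ℝ} (h : IsElliptic Ω γ l) :
    ∀ᵐ x ∂(volume.restrict Ω), ‖γ x‖ ≤ l := by
  have hl := h.pos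
  filter_upwards [h.bounds] with x hx
  rw [Real.norm_of_nonneg ((by positivity : (0:ℝ) ≤ 1 / l).trans hx.1)]
  exact hx.2

/-- The bilinear form `∫_Ω γ ∇u · ∇v` on `H¹(Ω)`. -/
noncomputable def IsElliptic.form {γ : EuclideanSpace ℝ (Fin d) → ℝ} {l : ℝ}
    (h : IsElliptic Ω γ l) : H1 Ω →L[ℝ] H1 Ω →L[ℝ] ℝ :=
  (innerSL ℝ).bilinearComp
    ((Lp.mulBounded h.aestronglyMeasurable h.ae_norm_le).comp (H1.gradL Ω)) (H1.gradL Ω)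

lemma IsElliptic.form_apply {γ : EuclideanSpace ℝ (Fin d) → ℝ} {l : ℝ}
    (h : IsElliptic Ω γ l) (u v : H1 Ω) :
    h.form u v = ∫ x in Ω, γ x * ⟪H1.grad u x, H1.grad v x⟫ :=
  Lp.inner_mulBounded h.aestronglyMeasurable h.ae_norm_le _ _

lemma IsElliptic.norm_sq_grad_le_form {γ : EuclideanSpace ℝ (Fin d) → ℝ} {l : ℝ}
    (h : IsElliptic Ω γ l) (u : H1 Ω) : 1 / l * ‖H1.grad u‖ ^ 2 ≤ h.form u u := by
  rw [h.form_apply, Lp.norm_sq_eq_integral, ← integral_const_mul]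
  have hi := Lp.integrable_mul_inner h.aestronglyMeasurable h.ae_norm_le (H1.grad u) (H1.grad u)
  refine integral_mono_ae ?_ hi ?_
  · have := (L2.integrable_inner (𝕜 := ℝ) (H1.grad u) (H1.grad u)).const_mul (1 / l)
    simpa only [real_inner_self_eq_norm_sq] using this
  · filter_upwards [h.bounds] with x hx
    rw [real_inner_self_eq_norm_sq]
    exact mul_le_mul_of_nonneg_right hx.1 (by positivity)

lemma H10.isClosed : IsClosed (H10 Ω : Set (H1 Ω)) := Submodule.isClosed_topologicalClosure _

-- Ellipticity bounds only the gradient part of the norm from below; on `H¹₀(Ω)` the Poincaré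
-- inequality controls the remaining `L²` part.
set_option maxHeartbeats 800000 in
lemma IsElliptic.exists_norm_sq_le_form {γ : EuclideanSpace ℝ (Fin d) → ℝ} {l : ℝ}
    (h : IsElliptic Ω γ l) (hd : 2 ≤ d) (hbdd : Bornology.IsBounded Ω) :
    ∃ c > 0, ∀ u ∈ H10 Ω, c * ‖u‖ ^ 2 ≤ h.form u u := by
  obtain ⟨C, hC⟩ := H10.exists_norm_toL2_le hd hbdd
  have hl := h.pos
  -- The Poincaré constant `C` is not known to be nonnegative, hence `max C 0`.
  refine ⟨1 / (l * (max C 0 + 1)), by positivity, fun u hu => ?_⟩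
  have h1 := hC u hu
  have h3 := H1.norm_sq u
  have h4 : C * ‖H1.grad u‖ ^ 2 ≤ max C 0 * ‖H1.grad u‖ ^ 2 := by
    gcongr
    exact le_max_left _ _
  have h5 : ‖u‖ ^ 2 ≤ (max C 0 + 1) * ‖H1.grad u‖ ^ 2 := by linarith
  refine le_trans ?_ (h.norm_sq_grad_le_form u)
  rw [div_mul_eq_mul_div, one_mul, div_mul_eq_mul_div, one_mul,
    div_le_div_iff₀ (by positivity) hl]
  calc ‖u‖ ^ 2 * l ≤ (max C 0 + 1) * ‖H1.grad u‖ ^ 2 * l := by gcongr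
    _ = _ := by ring

/-- Lax–Milgram on a subspace: a form that is coercive on `S` has in every coset of `S` an element
orthogonal to `S`. -/
lemma exists_mem_forall_form_add_eq_zero {X : Type*} [NormedAddCommGroup X] [InnerProductSpace ℝ X]
    (S : Submodule ℝ X) [CompleteSpace X] (hS : IsClosed (S : Set X))
    (B : X →L[ℝ] X →L[ℝ] ℝ) {c : ℝ} (hc : 0 < c)
    (hB : ∀ u ∈ S, c * ‖u‖ ^ 2 ≤ B u u) (v : X) : ∃ w ∈ S, ∀ φ ∈ S, B (v + w) φ = 0 := by
  have : CompleteSpace S := hS.completeSpace_coe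
  have hco : IsCoercive (B.bilinearComp S.subtypeL S.subtypeL) :=
    ⟨c, hc, fun u => by simpa [mul_assoc, sq] using hB u u.2⟩
  -- On `S` the functional `B w` is to equal `-B v`: Riesz represents the latter, and the
  -- Lax–Milgram isomorphism is inverted at its representative.
  set w : S := hco.continuousLinearEquivOfBilin.symm
    ((InnerProductSpace.toDual ℝ S).symm (-((B v).comp S.subtypeL))) with hw
  refine ⟨w, w.2, fun φ hφ => ?_⟩
  have h1 := hco.continuousLinearEquivOfBilin_apply w ⟨φ, hφ⟩
  rw [hw, ContinuousLinearEquiv.apply_symm_apply, InnerProductSpace.toDual_symm_apply, ← hw] at h1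
  have h2 : B.bilinearComp S.subtypeL S.subtypeL w ⟨φ, hφ⟩ = B w φ := rfl
  rw [h2] at h1
  rw [map_add, _root_.add_apply, ← h1]
  simp

set_option maxHeartbeats 800000 in
/-- Solvability of the Dirichlet problem: each `v ∈ H¹(Ω)` can be corrected by an element of
`H¹₀(Ω)` so as to be orthogonal to `H¹₀(Ω)` for the conductivity form. -/
lemma IsElliptic.exists_form_eq_zero {γ : EuclideanSpace ℝ (Fin d) → ℝ} {l : ℝ}
    (h : IsElliptic Ω γ l) (hd : 2 ≤ d) (hbdd : Bornology.IsBounded Ω) (v : H1 Ω) :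
    ∃ w ∈ H10 Ω, ∀ φ ∈ H10 Ω, h.form (v + w) φ = 0 := by
  obtain ⟨c, hc, hB⟩ := h.exists_norm_sq_le_form hd hbdd
  exact exists_mem_forall_form_add_eq_zero (H10 Ω) H10.isClosed h.form hc hB v

set_option maxHeartbeats 4000000 in
/-- The defining property of the Dirichlet-to-Neumann map. -/
lemma IsElliptic.exists_DtN {γ : EuclideanSpace ℝ (Fin d) → ℝ} {l : ℝ}
    (h : IsElliptic Ω γ l) (hd : 2 ≤ d) (hbdd : Bornology.IsBounded Ω) (f : HHalf Ω) :
    ∃ u : H1 Ω, H1.boundaryValue u = f ∧ IsConormalDerivative γ u (DtN Ω γ f) := by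
  obtain ⟨v, rfl⟩ := (H10 Ω).mkQ_surjective f
  -- This existence statement puts `DtN` in its first branch. The functional `B (v + w)` vanishes on
  -- `H¹₀(Ω)`, so it descends to the quotient.
  have hex : ∃ Λ : HNegHalf Ω, ∃ u : H1 Ω, H1.boundaryValue u = (H10 Ω).mkQ v ∧
      IsConductivitySolution γ u ∧ IsConormalDerivative γ u Λ := by
    obtain ⟨w, hw, hφ⟩ := h.exists_form_eq_zero hd hbdd v
    refine ⟨(H10 Ω).liftQL (h.form (v + w)) (fun φ hφ' => hφ φ hφ'), v + w, ?_, ?_, ?_⟩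
    · refine (Submodule.Quotient.eq _).2 ?_
      simpa using hw
    · intro φ hφ'
      have hmem : H1.ofSmooth Ω hφ'.smooth hφ'.hasCompactSupport ∈ H10 Ω :=
        Submodule.le_topologicalClosure _ (Submodule.subset_span
          ⟨φ, hφ', H1.toL2_ofSmooth _ _, H1.grad_ofSmooth _ _⟩)
      have h0 := hφ _ hmem
      rw [h.form_apply] at h0
      rw [← h0]
      refine integral_congr_ae ?_
      filter_upwards [H1.grad_ofSmooth (Ω := Ω) hφ'.smooth hφ'.hasCompactSupport] with x hx
      rw [hx]
    · intro φ
      rw [← h.form_apply]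
      rfl
  have hD : DtN Ω γ ((H10 Ω).mkQ v) = hex.choose := by
    unfold DtN
    rw [dif_pos hex]
  rw [hD]
  -- The equation itself can be dropped: the conormal identity contains it, because its left side
  -- depends only on boundary values.
  obtain ⟨u, h1, -, h3⟩ := hex.choose_spec
  exact ⟨u, h1, h3⟩

/-- A field in `L²` that is weakly divergence free in `Ω` is orthogonal to gradients of functions
in `H¹₀(Ω)`. -/
lemma H10.inner_grad_eq_zero {T : Lp (EuclideanSpace ℝ (Fin d)) 2 (volume.restrict Ω)}
    (hT : ∀ φ : EuclideanSpace ℝ (Fin d) → ℝ, IsTestFunction Ω φ → ∫ x in Ω, ⟪T x, ∇ φ x⟫ = 0)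
    {u : H1 Ω} (hu : u ∈ H10 Ω) : ⟪T, H1.grad u⟫ = 0 := by
  refine H10.induction (p := fun u => ⟪T, H1.grad u⟫ = 0) ?_ ?_ hu
  · simp only [← H1.gradL_apply]
    exact isClosed_eq (continuous_const.inner (H1.gradL Ω).continuous) continuous_const
  · intro u φ hφ _ h2
    rw [L2.inner_def, ← hT φ hφ]
    refine integral_congr_ae ?_
    filter_upwards [h2] with x hx
    rw [hx]

set_option maxHeartbeats 4000000 in
/-- If the Dirichlet-to-Neumann maps agree, the Dirichlet principle for `γ₁` and the Thomson
principle for `γ₂` give a comparison between the energy of an extension and the dual energy of a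
divergence free field. -/
lemma dual_energy_le_energy (hd : 2 ≤ d) (hbdd : Bornology.IsBounded Ω)
    {γ₁ γ₂ : EuclideanSpace ℝ (Fin d) → ℝ} {l₁ l₂ : ℝ} (h₁ : IsElliptic Ω γ₁ l₁)
    (h₂ : IsElliptic Ω γ₂ l₂) (hDtN : DtN Ω γ₁ = DtN Ω γ₂)
    {V : EuclideanSpace ℝ (Fin d) → ℝ} (hV : ContDiff ℝ ∞ V) (hc : HasCompactSupport V)
    {T : EuclideanSpace ℝ (Fin d) → EuclideanSpace ℝ (Fin d)} (hT : MemLp T 2 (volume.restrict Ω))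
    (hdiv : ∀ φ : EuclideanSpace ℝ (Fin d) → ℝ, IsTestFunction Ω φ →
      ∫ x in Ω, ⟪T x, ∇ φ x⟫ = 0) :
    2 * (∫ x in Ω, ⟪T x, ∇ V x⟫) - ∫ x in Ω, (γ₂ x)⁻¹ * ‖T x‖ ^ 2 ≤
      ∫ x in Ω, γ₁ x * ‖∇ V x‖ ^ 2 := by
  set v := H1.ofSmooth Ω hV hc with hv
  have hvg := H1.grad_ofSmooth (Ω := Ω) hV hc
  obtain ⟨u₁, hu₁, hΛ₁⟩ := h₁.exists_DtN hd hbdd (H1.boundaryValue v)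
  obtain ⟨u₂, hu₂, hΛ₂⟩ := h₂.exists_DtN hd hbdd (H1.boundaryValue v)
  rw [hDtN] at hΛ₁
  have a1 := hΛ₁ v
  have a2 := hΛ₁ u₁
  have a3 := hΛ₂ u₂
  rw [hu₁] at a2
  rw [hu₂] at a3
  rw [← h₁.form_apply] at a1 a2
  -- `A` is the common energy: it equals `∫ γ₁ ∇u₁ · ∇v`, `∫ γ₁ |∇u₁|²` and `∫ γ₂ |∇u₂|²`.
  set A := DtN Ω γ₂ (H1.boundaryValue v) (H1.boundaryValue v)
  -- upper bound
  have hVform : h₁.form v v = ∫ x in Ω, γ₁ x * ‖∇ V x‖ ^ 2 := by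
    rw [h₁.form_apply]
    refine integral_congr_ae ?_
    filter_upwards [hvg] with x hx
    rw [hx, real_inner_self_eq_norm_sq]
  have hsymm : h₁.form v u₁ = h₁.form u₁ v := by
    rw [h₁.form_apply, h₁.form_apply]
    simp only [real_inner_comm]
  -- Dirichlet principle: expanding the form at `u₁ - v`, three terms equal `±A` and leave `h₁.form
  -- v v - A ≥ 0`.
  have hpos : 0 ≤ h₁.form (u₁ - v) (u₁ - v) :=
    le_trans (by have := h₁.pos; positivity) (h₁.norm_sq_grad_le_form _)
  simp only [map_sub, _root_.sub_apply] at hpos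
  have hup : A ≤ ∫ x in Ω, γ₁ x * ‖∇ V x‖ ^ 2 := by linarith
  -- lower bound
  have hT' := hT.coeFn_toLp
  -- The field `T` does not distinguish `u₂` from `v`, since they differ by an element of `H¹₀(Ω)`.
  have horth : ⟪hT.toLp T, H1.grad u₂⟫ = ∫ x in Ω, ⟪T x, ∇ V x⟫ := by
    have hmem : u₂ - v ∈ H10 Ω := (Submodule.Quotient.eq _).1 hu₂
    have h0 : ⟪hT.toLp T, H1.grad (u₂ - v)⟫ = 0 := by
      refine H10.inner_grad_eq_zero (fun φ hφ => ?_) hmem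
      rw [← hdiv φ hφ]
      refine integral_congr_ae ?_
      filter_upwards [hT'] with x hx
      rw [hx]
    rw [← H1.gradL_apply, map_sub, inner_sub_right, sub_eq_zero, H1.gradL_apply, H1.gradL_apply]
      at h0
    rw [h0, L2.inner_def]
    refine integral_congr_ae ?_
    filter_upwards [hT', hvg] with x hx hx'
    rw [hx, hx']
  have hi1 := Lp.integrable_mul_inner h₂.aestronglyMeasurable h₂.ae_norm_le (H1.grad u₂) (H1.grad u₂)
  have hi2 : Integrable (fun x => ⟪T x, H1.grad u₂ x⟫) (volume.restrict Ω) := by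
    refine (L2.integrable_inner (𝕜 := ℝ) (hT.toLp T) (H1.grad u₂)).congr ?_
    filter_upwards [hT'] with x hx
    rw [hx]
  have hi3 : Integrable (fun x => (γ₂ x)⁻¹ * ‖T x‖ ^ 2) (volume.restrict Ω) := by
    refine (hT.integrable_norm_pow two_ne_zero).bdd_mul (c := l₂)
      h₂.aestronglyMeasurable.aemeasurable.inv.aestronglyMeasurable ?_
    have := h₂.pos
    filter_upwards [h₂.bounds] with x hx
    have h0 : 0 < γ₂ x := lt_of_lt_of_le (by positivity) hx.1
    rw [Real.norm_of_nonneg (by positivity), inv_le_comm₀ h0 this, ← one_div]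
    exact hx.1
  have hlow : 2 * (∫ x in Ω, ⟪T x, ∇ V x⟫) - ∫ x in Ω, (γ₂ x)⁻¹ * ‖T x‖ ^ 2 ≤ A := by
    have e1 : ⟪hT.toLp T, H1.grad u₂⟫ = ∫ x in Ω, ⟪T x, H1.grad u₂ x⟫ := by
      rw [L2.inner_def]
      refine integral_congr_ae ?_
      filter_upwards [hT'] with x hx
      rw [hx]
    rw [← horth, e1, a3, ← integral_const_mul, ← integral_sub (hi2.const_mul 2) hi3]
    refine integral_mono_ae ((hi2.const_mul 2).sub hi3) hi1 ?_
    have := h₂.pos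
    filter_upwards [h₂.bounds] with x hx
    have h0 : 0 < γ₂ x := lt_of_lt_of_le (by positivity) hx.1
    -- Thomson principle, pointwise: expanding `γ₂ |∇u₂ - γ₂⁻¹ T|² ≥ 0` gives `2 T · ∇u₂ - γ₂⁻¹ |T|²
    -- ≤ γ₂ |∇u₂|²`.
    have hn : 0 ≤ ‖H1.grad u₂ x - (γ₂ x)⁻¹ • T x‖ ^ 2 := by positivity
    rw [norm_sub_sq_real, inner_smul_right, norm_smul, norm_inv, Real.norm_of_nonneg h0.le,
      real_inner_comm] at hn
    rw [real_inner_self_eq_norm_sq]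
    have h5 := mul_nonneg h0.le hn
    have e2 : γ₂ x * (‖H1.grad u₂ x‖ ^ 2 - 2 * ((γ₂ x)⁻¹ * ⟪T x, H1.grad u₂ x⟫) +
      ((γ₂ x)⁻¹ * ‖T x‖) ^ 2) = γ₂ x * ‖H1.grad u₂ x‖ ^ 2 - (2 * ⟪T x, H1.grad u₂ x⟫ -
        (γ₂ x)⁻¹ * ‖T x‖ ^ 2) := by
      field_simp
      ring
    rw [e2] at h5
    linarith
  exact hlow.trans hup

end ConductivityForm

/-! ### Divergence free fields from rotated gradients. -/

section RotatedGradient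

lemma HasCompactSupport.comp_rescale {E F : Type*} [NormedAddCommGroup E] [NormedSpace ℝ E]
    [Zero F] {V : E → F}
    (hV : HasCompactSupport V)
    (z : E) {r : ℝ} (hr : r ≠ 0) :
    HasCompactSupport (fun x => V (r • (x - z))) :=
  hV.comp_homeomorph ((Homeomorph.subRight z).trans (Homeomorph.smulOfNeZero r hr))

variable {E : Type*} [NormedAddCommGroup E] [InnerProductSpace ℝ E] [FiniteDimensional ℝ E]

/-- The gradient of `W` in the plane of `p` and `q`, rotated by a right angle. -/
noncomputable def rotatedGradient (W : E → ℝ) (p q : E) (x : E) : E :=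
  ⟪∇ W x, p⟫ • q - ⟪∇ W x, q⟫ • p

lemma ContDiff.continuous_rotatedGradient {W : E → ℝ} (hW : ContDiff ℝ ∞ W) (p q : E) :
    Continuous (rotatedGradient W p q) := by
  have := hW.continuous_gradient (by simp)
  unfold rotatedGradient
  fun_prop

lemma HasCompactSupport.rotatedGradient {W : E → ℝ} (hc : HasCompactSupport W) (p q : E) :
    HasCompactSupport (rotatedGradient W p q) :=
  hc.gradient.comp_left (g := fun y => ⟪y, p⟫ • q - ⟪y, q⟫ • p) (by simp)

lemma inner_gradient_inner_gradient {W : E → ℝ} (hW : ContDiff ℝ ∞ W) (p q x : E) :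
    ⟪∇ (fun y => ⟪∇ W y, p⟫) x, q⟫ = fderiv ℝ (fderiv ℝ W) x q p := by
  have h : DifferentiableAt ℝ (fderiv ℝ W) x :=
    (hW.fderiv_right (m := 1) (by norm_cast)).differentiable one_ne_zero x
  rw [inner_gradient_left]
  simp only [inner_gradient_left]
  rw [fderiv_clm_apply h (differentiableAt_const p)]
  simp

lemma ContDiff.inner_gradient {W : E → ℝ} (hW : ContDiff ℝ ∞ W) (p : E) :
    ContDiff ℝ 1 (fun y => ⟪∇ W y, p⟫) := by
  simp only [inner_gradient_left]
  exact (hW.fderiv_right (m := 1) (by norm_cast)).clm_apply contDiff_const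

/-- After integration by parts the two terms carry the second derivative of `W` at `(q, p)` and at
`(p, q)`; its symmetry makes them cancel. This is the weak form of vanishing divergence. -/
lemma integral_inner_rotatedGradient [MeasurableSpace E] [BorelSpace E] {μ : Measure E}
    [μ.IsAddHaarMeasure] {W φ : E → ℝ} (hW : ContDiff ℝ ∞ W) (hφ : ContDiff ℝ 1 φ)
    (hc : HasCompactSupport φ) (p q : E) :
    ∫ x, ⟪rotatedGradient W p q x, ∇ φ x⟫ ∂μ = 0 := by
  have hW' := hW.continuous_gradient (by simp)
  have hφ' := hφ.continuous_gradient one_ne_zero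
  have hint : ∀ p q : E, Integrable (fun x => ⟪∇ W x, p⟫ * ⟪∇ φ x, q⟫) μ := fun p q =>
    Continuous.integrable_of_hasCompactSupport (by fun_prop)
      (HasCompactSupport.mul_left (hc.gradient.comp_left (g := fun y => ⟪y, q⟫) (by simp)))
  have h1 : ∀ x, ⟪rotatedGradient W p q x, ∇ φ x⟫ =
      ⟪∇ W x, p⟫ * ⟪∇ φ x, q⟫ - ⟪∇ W x, q⟫ * ⟪∇ φ x, p⟫ := fun x => by
    rw [rotatedGradient, inner_sub_left, real_inner_smul_left, real_inner_smul_left,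
      real_inner_comm (∇ φ x) q, real_inner_comm (∇ φ x) p]
  simp only [h1]
  rw [integral_sub (hint p q) (hint q p),
    integral_mul_inner_gradient (hW.inner_gradient p) hφ hc q,
    integral_mul_inner_gradient (hW.inner_gradient q) hφ hc p, sub_eq_zero]
  congr 2
  ext x
  rw [inner_gradient_inner_gradient hW, inner_gradient_inner_gradient hW]
  congr 1
  exact (hW.contDiffAt.isSymmSndFDerivAt (by
    rw [minSmoothness_of_isRCLikeNormedField]
    exact WithTop.coe_le_coe.2 (le_top (a := (2 : ℕ∞))))) q p

lemma gradient_comp_rescale {V : E → ℝ} (hV : Differentiable ℝ V) (z : E) (r : ℝ) (x : E) :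
    ∇ (fun x => V (r • (x - z))) x = r • ∇ V (r • (x - z)) := by
  have h : HasFDerivAt (fun x : E => r • (x - z)) (r • ContinuousLinearMap.id ℝ E) x :=
    ((hasFDerivAt_id x).sub_const z).const_smul r
  have h2 := ((hV (r • (x - z))).hasFDerivAt.comp x h).fderiv
  refine ext_inner_right ℝ fun c => ?_
  rw [real_inner_smul_left, inner_gradient_left, inner_gradient_left]
  change fderiv ℝ (V ∘ fun x => r • (x - z)) x c = _
  rw [h2]
  simp

end RotatedGradient

/-! ### Concentration at a boundary point and passage to the tangent half-space. -/

section BlowUp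

variable {d : ℕ} {Ω : Set (EuclideanSpace ℝ (Fin d))}

lemma setIntegral_inner_rotatedGradient {W φ : EuclideanSpace ℝ (Fin d) → ℝ} (hW : ContDiff ℝ ∞ W)
    (hφ : IsTestFunction Ω φ) (p q : EuclideanSpace ℝ (Fin d)) :
    ∫ x in Ω, ⟪rotatedGradient W p q x, ∇ φ x⟫ = 0 := by
  rw [setIntegral_eq_integral_of_forall_compl_eq_zero]
  · exact integral_inner_rotatedGradient hW hφ.contDiff_one hφ.hasCompactSupport p q
  · intro x hx
    rw [gradient_eq_zero_of_notMem_tsupport (fun h => hx (hφ.tsupport_subset h)), inner_zero_right]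

/-- The comparison of energies for functions concentrated at scale `r⁻¹` about `z`. -/
lemma rescaled_dual_energy_le_energy (hd : 2 ≤ d) (hbdd : Bornology.IsBounded Ω)
    {γ₁ γ₂ : EuclideanSpace ℝ (Fin d) → ℝ} {l₁ l₂ : ℝ} (h₁ : IsElliptic Ω γ₁ l₁)
    (h₂ : IsElliptic Ω γ₂ l₂) (hDtN : DtN Ω γ₁ = DtN Ω γ₂)
    {V W : EuclideanSpace ℝ (Fin d) → ℝ} (hV : ContDiff ℝ ∞ V) (hc : HasCompactSupport V)
    (hW : ContDiff ℝ ∞ W) (hcW : HasCompactSupport W) (p q z : EuclideanSpace ℝ (Fin d))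
    (a : ℝ) {r : ℝ} (hr : r ≠ 0) :
    2 * a * (∫ x in Ω, ⟪rotatedGradient W p q (r • (x - z)), ∇ V (r • (x - z))⟫) -
      a ^ 2 * (∫ x in Ω, (γ₂ x)⁻¹ * ‖rotatedGradient W p q (r • (x - z))‖ ^ 2) ≤
      ∫ x in Ω, γ₁ x * ‖∇ V (r • (x - z))‖ ^ 2 := by
  have haff : ContDiff ℝ ∞ (fun x : EuclideanSpace ℝ (Fin d) => r • (x - z)) := by fun_prop
  have hgV := gradient_comp_rescale (hV.differentiable (by simp)) z r
  have hrot : ∀ x, rotatedGradient (fun x => W (r • (x - z))) p q x =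
      r • rotatedGradient W p q (r • (x - z)) := fun x => by
    rw [rotatedGradient, gradient_comp_rescale (hW.differentiable (by simp)) z r,
      real_inner_smul_left, real_inner_smul_left, mul_smul, mul_smul, ← smul_sub, rotatedGradient]
  have hWr : ContDiff ℝ ∞ (fun x => W (r • (x - z))) := hW.comp haff
  have hT : MemLp (fun x => a • rotatedGradient (fun x => W (r • (x - z))) p q x) 2
      (volume.restrict Ω) :=
    ((hWr.continuous_rotatedGradient p q).memLp_of_hasCompactSupport
      ((hcW.comp_rescale z hr).rotatedGradient p q)).const_smul a
  have key := dual_energy_le_energy hd hbdd h₁ h₂ hDtN (hV.comp haff) (hc.comp_rescale z hr) hT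
    (fun φ hφ => by
      simp only [real_inner_smul_left]
      rw [integral_const_mul, setIntegral_inner_rotatedGradient hWr hφ, mul_zero])
  have e1 : ∀ x, ⟪a • rotatedGradient (fun x => W (r • (x - z))) p q x,
      ∇ (V ∘ fun x => r • (x - z)) x⟫ = (r ^ 2 * a) *
        ⟪rotatedGradient W p q (r • (x - z)), ∇ V (r • (x - z))⟫ := fun x => by
    rw [hrot]
    change ⟪_, ∇ (fun x => V (r • (x - z))) x⟫ = _
    rw [hgV, real_inner_smul_left, real_inner_smul_left, inner_smul_right]
    ring
  have e2 : ∀ x, (γ₂ x)⁻¹ * ‖a • rotatedGradient (fun x => W (r • (x - z))) p q x‖ ^ 2 =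
      (r ^ 2 * a ^ 2) * ((γ₂ x)⁻¹ * ‖rotatedGradient W p q (r • (x - z))‖ ^ 2) := fun x => by
    rw [hrot, norm_smul, norm_smul, mul_pow, mul_pow, Real.norm_eq_abs, Real.norm_eq_abs, sq_abs,
      sq_abs]
    ring
  have e3 : ∀ x, γ₁ x * ‖∇ (V ∘ fun x => r • (x - z)) x‖ ^ 2 =
      r ^ 2 * (γ₁ x * ‖∇ V (r • (x - z))‖ ^ 2) := fun x => by
    change γ₁ x * ‖∇ (fun x => V (r • (x - z))) x‖ ^ 2 = _
    rw [hgV, norm_smul, mul_pow, Real.norm_eq_abs, sq_abs]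
    ring
  -- Each of the three terms is quadratic in gradients and so carries the same factor `r ^ 2`, which
  -- cancels.
  simp only [e1, e2, e3, integral_const_mul] at key
  have hr2 : 0 < r ^ 2 := by positivity
  refine le_of_mul_le_mul_left ?_ hr2
  linarith

/-- Near a boundary point, the boundary of the set lies on the graph. -/
lemma IsC1OpenSet.graph_of_mem_frontier {z e : EuclideanSpace ℝ (Fin d)} {r : ℝ}
    {ψ : EuclideanSpace ℝ (Fin d) → ℝ} (hΩ : IsOpen Ω) (hψ : Continuous ψ)
    (h : ∀ x ∈ ball z r, x ∈ Ω ↔ ψ (x - ⟪e, x⟫ • e) < ⟪e, x⟫)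
    {x : EuclideanSpace ℝ (Fin d)} (hx : x ∈ ball z r) (hxf : x ∈ frontier Ω) :
    ψ (x - ⟪e, x⟫ • e) = ⟪e, x⟫ := by
  rw [hΩ.frontier_eq] at hxf
  refine le_antisymm ?_ (not_lt.1 fun h' => hxf.2 ((h x hx).2 h'))
  refine not_lt.1 fun hlt => ?_
  have hopen : IsOpen {y | ⟪e, y⟫ < ψ (y - ⟪e, y⟫ • e)} :=
    isOpen_lt (by fun_prop) (by fun_prop)
  obtain ⟨y, ⟨hy1, hy2⟩, hy3⟩ := mem_closure_iff.1 hxf.1 _ (hopen.inter isOpen_ball) ⟨hlt, hx⟩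
  exact lt_asymm hy1 ((h y hy2).1 hy3)

/-- At a boundary point of a `C¹` open set, the blow-ups converge to a half-space. -/
lemma IsC1OpenSet.exists_inner_normal (hΩ : IsC1OpenSet Ω) {z : EuclideanSpace ℝ (Fin d)}
    (hz : z ∈ frontier Ω) : ∃ n : EuclideanSpace ℝ (Fin d), ‖n‖ = 1 ∧ ∀ y, ⟪n, y⟫ ≠ 0 →
      ∀ᶠ r in 𝓝[>] (0 : ℝ), (z + r • y ∈ Ω ↔ 0 < ⟪n, y⟫) := by
  obtain ⟨R, hR, e, he, ψ, hψ, hgr⟩ := hΩ.exists_graph z hz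
  set P : EuclideanSpace ℝ (Fin d) →L[ℝ] EuclideanSpace ℝ (Fin d) :=
    ContinuousLinearMap.id ℝ _ - (innerSL ℝ e).smulRight e with hP
  have hPx : ∀ x, P x = x - ⟪e, x⟫ • e := fun x => by simp [hP]
  -- `L` is the derivative at `z` of the defining function `⟪e, x⟫ - ψ (P x)`, with `P` the
  -- projection along `e`. It is nonzero because it takes the value `1` at `e`; its normalised
  -- gradient is the inner normal.
  set L : StrongDual ℝ (EuclideanSpace ℝ (Fin d)) := innerSL ℝ e - (fderiv ℝ ψ (P z)).comp P with hL
  have hLe : L e = 1 := by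
    have : P e = 0 := by simp [hPx, he]
    simp [hL, this, he]
  set m := (InnerProductSpace.toDual ℝ (EuclideanSpace ℝ (Fin d))).symm L with hm
  have hmy : ∀ y, ⟪m, y⟫ = L y := fun y => InnerProductSpace.toDual_symm_apply
  have hm0 : m ≠ 0 := by
    intro h0
    have := hmy e
    rw [h0, inner_zero_left, hLe] at this
    exact zero_ne_one this
  have hmn : 0 < ‖m‖ := norm_pos_iff.2 hm0
  refine ⟨‖m‖⁻¹ • m, norm_smul_inv_norm hm0, fun y hy => ?_⟩
  rw [real_inner_smul_left, hmy] at hy ⊢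
  have hLy : L y ≠ 0 := right_ne_zero_of_mul hy
  -- Near `z`, the sign of `g` decides membership in `Ω` along the ray in the direction `y`. Since
  -- `g 0 = 0` and `g` has slope `L y ≠ 0` there, this sign is that of `L y` for small `r > 0`.
  set g : ℝ → ℝ := fun r => ⟪e, z + r • y⟫ - ψ (P (z + r • y)) with hg
  have hg0 : g 0 = 0 := by
    have := IsC1OpenSet.graph_of_mem_frontier hΩ.isOpen hψ.continuous hgr (mem_ball_self hR) hz
    simp only [hg, zero_smul, add_zero, hPx, this, sub_self]
  have hline : HasDerivAt (fun r : ℝ => z + r • y) y 0 := by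
    simpa using ((hasDerivAt_id (0 : ℝ)).smul_const y).const_add z
  have hder : HasDerivAt g (L y) 0 := by
    have h1 : HasDerivAt (fun r : ℝ => ⟪e, z + r • y⟫) ⟪e, y⟫ 0 :=
      (innerSL ℝ e).hasFDerivAt.comp_hasDerivAt (0 : ℝ) hline
    have h2 : HasDerivAt (fun r : ℝ => P (z + r • y)) (P y) 0 :=
      P.hasFDerivAt.comp_hasDerivAt (0 : ℝ) hline
    have h3 : HasFDerivAt ψ (fderiv ℝ ψ (P z)) (P (z + (0 : ℝ) • y)) := by
      rw [zero_smul, add_zero]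
      exact (hψ.differentiable one_ne_zero _).hasFDerivAt
    have h4 := HasFDerivAt.comp_hasDerivAt (f := fun r : ℝ => P (z + r • y)) (0 : ℝ) h3 h2
    exact h1.sub h4
  have hslope := (hder.tendsto_slope).mono_left (nhdsWithin_mono (0 : ℝ) (s := Set.Ioi 0)
    (t := {0}ᶜ) (fun x hx => ne_of_gt hx))
  have hball : ∀ᶠ r in 𝓝[>] (0 : ℝ), z + r • y ∈ ball z R := by
    refine nhdsWithin_le_nhds ?_
    refine hline.continuousAt.eventually_mem ?_
    simpa using ball_mem_nhds z hR
  have hmem : ∀ᶠ r in 𝓝[>] (0 : ℝ), (z + r • y ∈ Ω ↔ 0 < slope g 0 r) := by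
    filter_upwards [hball, self_mem_nhdsWithin] with r hr hr0
    rw [hgr _ hr, slope_def_field, hg0, sub_zero, sub_zero, div_pos_iff_of_pos_right hr0]
    simp only [hg, hPx, sub_pos]
  rcases lt_or_gt_of_ne hLy with hneg | hpos
  · filter_upwards [hmem, hslope.eventually (gt_mem_nhds hneg)] with r h1 h2
    rw [h1]
    exact iff_of_false (not_lt.2 h2.le) (not_lt.2 (mul_nonpos_of_nonneg_of_nonpos
      (by positivity) hneg.le))
  · filter_upwards [hmem, hslope.eventually (lt_mem_nhds hpos)] with r h1 h2
    rw [h1]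
    exact iff_of_true h2 (by positivity)

lemma setIntegral_rescale (hΩ : MeasurableSet Ω) (F : EuclideanSpace ℝ (Fin d) → ℝ)
    (z : EuclideanSpace ℝ (Fin d)) {r : ℝ} (hr : 0 < r) :
    ∫ x in Ω, F (r⁻¹ • (x - z)) =
      r ^ d * ∫ y, {y | z + r • y ∈ Ω}.indicator F y := by
  have h1 : ∀ x, Ω.indicator (fun x => F (r⁻¹ • (x - z))) x =
      {y | z + r • y ∈ Ω}.indicator F (r⁻¹ • (x - z)) := fun x => by
    have : z + r • r⁻¹ • (x - z) = x := by rw [smul_inv_smul₀ hr.ne']; abel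
    by_cases hx : x ∈ Ω
    · rw [Set.indicator_of_mem hx, Set.indicator_of_mem]
      simpa [this] using hx
    · rw [Set.indicator_of_notMem hx, Set.indicator_of_notMem]
      simpa [this] using hx
  rw [← integral_indicator hΩ]
  simp only [h1]
  rw [integral_sub_right_eq_self (fun x => {y | z + r • y ∈ Ω}.indicator F (r⁻¹ • x)) z,
    Measure.integral_comp_inv_smul_of_nonneg _ _ hr.le]
  simp

/-- Rescaled integrals over `Ω` converge to integrals over the tangent half-space. -/
lemma tendsto_rescaled_setIntegral (hΩ : IsOpen Ω) {z n : EuclideanSpace ℝ (Fin d)} (hn : ‖n‖ = 1)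
    (hblow : ∀ y, ⟪n, y⟫ ≠ 0 → ∀ᶠ r in 𝓝[>] (0 : ℝ), (z + r • y ∈ Ω ↔ 0 < ⟪n, y⟫))
    {F : EuclideanSpace ℝ (Fin d) → ℝ} (hF : Continuous F) (hc : HasCompactSupport F) :
    Tendsto (fun r : ℝ => (r ^ d)⁻¹ * ∫ x in Ω, F (r⁻¹ • (x - z))) (𝓝[>] 0)
      (𝓝 (∫ y in {y | 0 < ⟪n, y⟫}, F y)) := by
  have hH : MeasurableSet {y : EuclideanSpace ℝ (Fin d) | 0 < ⟪n, y⟫} :=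
    (isOpen_lt (by fun_prop) (by fun_prop)).measurableSet
  -- The blow-up hypothesis says nothing on the hyperplane orthogonal to `n`, which is null;
  -- elsewhere the indicators are eventually constant, and `‖F‖` dominates.
  have hnull : ∀ᵐ y : EuclideanSpace ℝ (Fin d), ⟪n, y⟫ ≠ 0 := by
    have h := Measure.addHaar_submodule (volume : Measure (EuclideanSpace ℝ (Fin d)))
      (LinearMap.ker (innerSL ℝ n).toLinearMap) (by
        intro h
        have : n ∈ LinearMap.ker (innerSL ℝ n).toLinearMap := by rw [h]; trivial
        simp [hn] at this)
    rw [ae_iff]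
    convert h using 2
    ext y
    simp
  rw [← integral_indicator hH]
  have hlim : Tendsto (fun r : ℝ => ∫ y, {y | z + r • y ∈ Ω}.indicator F y) (𝓝[>] 0)
      (𝓝 (∫ y, {y | 0 < ⟪n, y⟫}.indicator F y)) := by
    refine tendsto_integral_filter_of_dominated_convergence (fun y => ‖F y‖) ?_ ?_
      (hF.integrable_of_hasCompactSupport hc).norm ?_
    · refine Eventually.of_forall fun r => ?_
      exact hF.aestronglyMeasurable.indicator
        (hΩ.measurableSet.preimage (by fun_prop : Measurable fun y => z + r • y))
    · exact Eventually.of_forall fun r => Eventually.of_forall fun y => norm_indicator_le_norm_self _ _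
    · filter_upwards [hnull] with y hy
      refine tendsto_const_nhds.congr' ?_
      filter_upwards [hblow y hy] with r hr
      simp only [Set.indicator, Set.mem_ofPred_eq, hr]
  refine hlim.congr' ?_
  filter_upwards [self_mem_nhdsWithin] with r hr
  rw [setIntegral_rescale hΩ.measurableSet F z hr, inv_mul_cancel_left₀ (pow_pos hr d).ne']

/-- Rescaled integrals of `γ` against a compactly supported function only see the boundary value
of `γ`. -/
lemma HasBoundaryValueAt.tendsto_rescaled_setIntegral (hΩ : IsOpen Ω)
    {z n : EuclideanSpace ℝ (Fin d)} (hn : ‖n‖ = 1)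
    (hblow : ∀ y, ⟪n, y⟫ ≠ 0 → ∀ᶠ r in 𝓝[>] (0 : ℝ), (z + r • y ∈ Ω ↔ 0 < ⟪n, y⟫))
    {γ : EuclideanSpace ℝ (Fin d) → ℝ} (hγ : IntegrableOn γ Ω) (hbdd : Bornology.IsBounded Ω) {a : ℝ}
    (ha : HasBoundaryValueAt Ω γ z a)
    {F : EuclideanSpace ℝ (Fin d) → ℝ} (hF : Continuous F) (hc : HasCompactSupport F) :
    Tendsto (fun r : ℝ => (r ^ d)⁻¹ * ∫ x in Ω, γ x * F (r⁻¹ • (x - z))) (𝓝[>] 0)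
      (𝓝 (a * ∫ y in {y | 0 < ⟪n, y⟫}, F y)) := by
  have hfin : volume Ω ≠ ⊤ := hbdd.measure_lt_top.ne
  obtain ⟨M, hM⟩ := hc.exists_bound_of_continuous hF
  have hM0 : 0 ≤ M := (norm_nonneg _).trans (hM 0)
  obtain ⟨K, hK0, hK⟩ : ∃ K > 0, ∀ y, F y ≠ 0 → ‖y‖ < K := by
    obtain ⟨K, hK⟩ := hc.isCompact.isBounded.exists_norm_le
    refine ⟨max K 0 + 1, by positivity, fun y hy => ?_⟩
    have := hK y (subset_tsupport F hy)
    have := le_max_left K 0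
    linarith
  have hga : IntegrableOn (fun x => |γ x - a|) Ω := (hγ.sub (integrableOn_const hfin)).abs
  have hi1 : ∀ r : ℝ, IntegrableOn (fun x => (γ x - a) * F (r⁻¹ • (x - z))) Ω := fun r =>
    (hγ.sub (integrableOn_const hfin)).mul_bdd (c := M)
      (hF.comp (by fun_prop)).aestronglyMeasurable (Eventually.of_forall fun x => hM _)
  have hi2 : ∀ r : ℝ, IntegrableOn (fun x => a * F (r⁻¹ • (x - z))) Ω := fun r =>
    (integrableOn_const hfin).mul_bdd (c := M)
      (hF.comp (by fun_prop)).aestronglyMeasurable (Eventually.of_forall fun x => hM _)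
  -- The integrand is at most `M * |γ - a|` and vanishes outside a ball of radius `K * r`, whose
  -- volume is comparable to `r ^ d`. The normalised integral is thus bounded by a fixed multiple of
  -- the mean of `|γ - a|`.
  have hsmall : Tendsto (fun r : ℝ => (r ^ d)⁻¹ * ∫ x in Ω, (γ x - a) * F (r⁻¹ • (x - z)))
      (𝓝[>] 0) (𝓝 0) := by
    have hscale : Tendsto (fun r : ℝ => K * r) (𝓝[>] 0) (𝓝[>] 0) := by
      refine tendsto_nhdsWithin_iff.2 ⟨?_, ?_⟩
      · refine Tendsto.mono_left ?_ nhdsWithin_le_nhds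
        exact (by fun_prop : Continuous fun r : ℝ => K * r).tendsto' 0 0 (by simp)
      · filter_upwards [self_mem_nhdsWithin] with r hr
        exact mul_pos hK0 hr
    have hlim : Tendsto (fun r : ℝ => (M * (K ^ d * volume.real (ball (0 : EuclideanSpace ℝ (Fin d)) 1)))
        * ⨍ x in ball z (K * r) ∩ Ω, |γ x - a|) (𝓝[>] 0) (𝓝 0) := by
      simpa using (ha.comp hscale).const_mul
        (M * (K ^ d * volume.real (ball (0 : EuclideanSpace ℝ (Fin d)) 1)))
    refine squeeze_zero_norm' ?_ hlim
    filter_upwards [self_mem_nhdsWithin] with r (hr : 0 < r)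
    have hrd : 0 < r ^ d := pow_pos hr d
    set B := ball z (K * r) ∩ Ω with hB
    have hBm : MeasurableSet B := measurableSet_ball.inter hΩ.measurableSet
    have hBfin : volume B ≠ ⊤ := ne_top_of_le_ne_top hfin (measure_mono Set.inter_subset_right)
    have hle : ‖∫ x in Ω, (γ x - a) * F (r⁻¹ • (x - z))‖ ≤ M * ∫ x in B, |γ x - a| := by
      rw [← integral_const_mul, ← integral_indicator hBm,
        ← setIntegral_eq_integral_of_forall_compl_eq_zero (s := Ω)
          (f := B.indicator fun x => M * |γ x - a|)
          (fun x hx => Set.indicator_of_notMem (fun h => hx h.2) _)]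
      refine norm_integral_le_of_norm_le ((hga.const_mul M).indicator hBm) ?_
      filter_upwards [ae_restrict_mem hΩ.measurableSet] with x hx
      by_cases hxB : x ∈ B
      · rw [Set.indicator_of_mem hxB, norm_mul, mul_comm, Real.norm_eq_abs (γ x - a)]
        gcongr
        exact hM _
      · rw [Set.indicator_of_notMem hxB]
        have : F (r⁻¹ • (x - z)) = 0 := by
          by_contra h
          refine hxB ⟨?_, hx⟩
          have := hK _ h
          rw [norm_smul, Real.norm_of_nonneg (by positivity), inv_mul_lt_iff₀ hr] at this
          rw [mem_ball, dist_eq_norm]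
          linarith
        simp [this]
    have havg : ∫ x in B, |γ x - a| = volume.real B * ⨍ x in B, |γ x - a| := by
      rw [setAverage_eq, smul_eq_mul]
      -- The set average over a null set is `0` by convention, which agrees with the vanishing
      -- integral.
      by_cases h0 : volume.real B = 0
      · rw [h0, zero_mul]
        rw [measureReal_eq_zero_iff hBfin] at h0
        rw [Measure.restrict_eq_zero.2 h0, integral_zero_measure]
      · rw [mul_inv_cancel_left₀ h0]
    have havg0 : 0 ≤ ⨍ x in B, |γ x - a| := by
      rw [setAverage_eq]
      exact smul_nonneg (by positivity) (integral_nonneg fun x => abs_nonneg _)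
    have hvol : volume.real B ≤ (K * r) ^ d * volume.real (ball (0 : EuclideanSpace ℝ (Fin d)) 1) := by
      refine (measureReal_mono Set.inter_subset_left measure_ball_lt_top.ne).trans ?_
      rw [measureReal_def, Measure.addHaar_ball_of_pos _ _ (mul_pos hK0 hr), ENNReal.toReal_mul,
        ENNReal.toReal_ofReal (by positivity)]
      simp [measureReal_def]
    rw [norm_mul, Real.norm_of_nonneg (by positivity : 0 ≤ (r ^ d)⁻¹), inv_mul_le_iff₀ hrd]
    refine hle.trans ?_
    rw [havg]
    calc M * (volume.real B * ⨍ x in B, |γ x - a|) ≤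
        M * (((K * r) ^ d * volume.real (ball (0 : EuclideanSpace ℝ (Fin d)) 1)) *
          ⨍ x in B, |γ x - a|) := by gcongr
      _ = _ := by rw [mul_pow]; ring
  have hmain := (_root_.tendsto_rescaled_setIntegral hΩ hn hblow hF hc).const_mul a
  have hsum := hsmall.add hmain
  rw [zero_add] at hsum
  refine hsum.congr fun r => ?_
  rw [mul_left_comm a, ← integral_const_mul a, ← mul_add, ← integral_add (hi1 r) (hi2 r)]
  congr 2
  ext x
  ring

end BlowUp

/-! ### The limiting inequality between the two boundary values. -/

section Comparison

variable {d : ℕ} {Ω : Set (EuclideanSpace ℝ (Fin d))}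

/-- Inversion is Lipschitz away from zero: `|γ⁻¹ - a⁻¹| = |γ - a| / (γ a) ≤ l a⁻¹ |γ - a|`. -/
lemma HasBoundaryValueAt.inv {γ : EuclideanSpace ℝ (Fin d) → ℝ} {l a : ℝ}
    {z : EuclideanSpace ℝ (Fin d)} (hγ : IsElliptic Ω γ l) (hi : IntegrableOn γ Ω)
    (hbdd : Bornology.IsBounded Ω) (ha : HasBoundaryValueAt Ω γ z a) (ha0 : 0 < a) :
    HasBoundaryValueAt Ω (fun x => (γ x)⁻¹) z a⁻¹ := by
  have hl := hγ.pos
  have hlim : Tendsto (fun r : ℝ => l * a⁻¹ * ⨍ x in ball z r ∩ Ω, |γ x - a|) (𝓝[>] 0) (𝓝 0) := by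
    simpa using Tendsto.const_mul (l * a⁻¹) ha
  refine squeeze_zero (fun r => ?_) (fun r => ?_) hlim
  · rw [setAverage_eq]
    exact smul_nonneg (by positivity) (integral_nonneg fun x => abs_nonneg _)
  · have hfin : volume (ball z r ∩ Ω) ≠ ⊤ :=
      ne_top_of_le_ne_top hbdd.measure_lt_top.ne (measure_mono Set.inter_subset_right)
    rw [setAverage_eq, setAverage_eq, smul_eq_mul, smul_eq_mul, mul_left_comm,
      ← integral_const_mul (l * a⁻¹)]
    refine mul_le_mul_of_nonneg_left ?_ (inv_nonneg.2 measureReal_nonneg)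
    refine integral_mono_of_nonneg (Eventually.of_forall fun x => abs_nonneg (_ : ℝ)) ?_ ?_
    · exact (((hi.mono_set Set.inter_subset_right).sub (integrableOn_const hfin)).abs).const_mul _
    · filter_upwards [ae_restrict_of_ae_restrict_of_subset Set.inter_subset_right hγ.bounds]
        with x hx
      have h0 : 0 < γ x := lt_of_lt_of_le (by positivity) hx.1
      have h1 : (γ x)⁻¹ ≤ l := by
        rw [inv_le_comm₀ h0 hl, ← one_div]
        exact hx.1
      rw [inv_sub_inv h0.ne' ha0.ne', abs_div, abs_mul, abs_of_pos h0, abs_of_pos ha0,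
        abs_sub_comm, div_eq_mul_inv, mul_inv, mul_comm]
      gcongr

/-- The limit of `rescaled_dual_energy_le_energy` at a boundary point where both conductivities
have boundary values. -/
lemma boundaryValue_mul_dual_energy_le (hd : 2 ≤ d) (hbdd : Bornology.IsBounded Ω)
    (hΩ : IsOpen Ω) {γ₁ γ₂ : EuclideanSpace ℝ (Fin d) → ℝ} {l₁ l₂ : ℝ}
    (h₁ : IsElliptic Ω γ₁ l₁) (h₂ : IsElliptic Ω γ₂ l₂) (hi₁ : IntegrableOn γ₁ Ω)
    (hi₂ : IntegrableOn γ₂ Ω) (hDtN : DtN Ω γ₁ = DtN Ω γ₂)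
    {z n : EuclideanSpace ℝ (Fin d)} (hn : ‖n‖ = 1)
    (hblow : ∀ y, ⟪n, y⟫ ≠ 0 → ∀ᶠ r in 𝓝[>] (0 : ℝ), (z + r • y ∈ Ω ↔ 0 < ⟪n, y⟫))
    {a₁ a₂ : ℝ} (ha₁ : HasBoundaryValueAt Ω γ₁ z a₁) (ha₂ : HasBoundaryValueAt Ω γ₂ z a₂)
    {V W : EuclideanSpace ℝ (Fin d) → ℝ} (hV : ContDiff ℝ ∞ V) (hc : HasCompactSupport V)
    (hW : ContDiff ℝ ∞ W) (hcW : HasCompactSupport W) (p q : EuclideanSpace ℝ (Fin d))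
    (hpos : 0 < ∫ y in {y | 0 < ⟪n, y⟫}, ‖∇ V y‖ ^ 2) :
    0 < a₂ ∧ a₂ * ((∫ y in {y | 0 < ⟪n, y⟫}, ‖∇ V y‖ ^ 2) -
      ∫ y in {y | 0 < ⟪n, y⟫}, ‖∇ V y - rotatedGradient W p q y‖ ^ 2) ≤
      a₁ * ∫ y in {y | 0 < ⟪n, y⟫}, ‖∇ V y‖ ^ 2 := by
  have hVc := hV.continuous_gradient (by simp)
  have hTc := hW.continuous_rotatedGradient p q
  have hTs := hcW.rotatedGradient p q
  set T := rotatedGradient W p q with hT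
  have c1 : Continuous fun y => ‖∇ V y‖ ^ 2 := by fun_prop
  have c2 : Continuous fun y => ‖T y‖ ^ 2 := by fun_prop
  have c3 : Continuous fun y => ⟪T y, ∇ V y⟫ := by fun_prop
  have s1 : HasCompactSupport fun y => ‖∇ V y‖ ^ 2 :=
    hc.gradient.comp_left (g := fun y => ‖y‖ ^ 2) (by simp)
  have s2 : HasCompactSupport fun y => ‖T y‖ ^ 2 :=
    hTs.comp_left (g := fun y => ‖y‖ ^ 2) (by simp)
  have s3 : HasCompactSupport fun y => ⟪T y, ∇ V y⟫ :=
    hTs.mono fun y hy => by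
      contrapose! hy
      simp only [Function.mem_support, not_not] at hy ⊢
      rw [hy, inner_zero_left]
  have hfin : volume Ω ≠ ⊤ := hbdd.measure_lt_top.ne
  have hl2 := h₂.pos
  -- The lower bound `1 / l₂ ≤ γ₂` passes to the limit when integrated against the nonzero weight
  -- `‖∇ V‖ ^ 2`.
  have ha2pos : 0 < a₂ := by
    have t1 := ha₂.tendsto_rescaled_setIntegral hΩ hn hblow hi₂ hbdd c1 s1
    have t2 := (tendsto_rescaled_setIntegral hΩ hn hblow c1 s1).const_mul (1 / l₂)
    have hle := le_of_tendsto_of_tendsto t2 t1 (by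
      filter_upwards [self_mem_nhdsWithin] with r (hr : 0 < r)
      obtain ⟨M, hM⟩ := s1.exists_bound_of_continuous c1
      rw [mul_left_comm, ← integral_const_mul]
      refine mul_le_mul_of_nonneg_left ?_ (by positivity)
      refine integral_mono_ae ?_ ?_ ?_
      · exact (integrableOn_const hfin).mul_bdd (c := M)
          (c1.comp (by fun_prop : Continuous fun x => r⁻¹ • (x - z))).aestronglyMeasurable
          (Eventually.of_forall fun x => hM _)
      · exact hi₂.mul_bdd (c := M)
          (c1.comp (by fun_prop : Continuous fun x => r⁻¹ • (x - z))).aestronglyMeasurable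
          (Eventually.of_forall fun x => hM _)
      · filter_upwards [h₂.bounds] with x hx
        exact mul_le_mul_of_nonneg_right hx.1 (by positivity))
    have h0 : 0 < 1 / l₂ * ∫ y in {y | 0 < ⟪n, y⟫}, ‖∇ V y‖ ^ 2 :=
      mul_pos (one_div_pos.2 hl2) hpos
    exact lt_of_not_ge fun hneg => absurd (h0.trans_le hle)
      (not_lt.2 (mul_nonpos_of_nonpos_of_nonneg hneg hpos.le))
  refine ⟨ha2pos, ?_⟩
  have t1 := ha₁.tendsto_rescaled_setIntegral hΩ hn hblow hi₁ hbdd c1 s1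
  have hinv : IntegrableOn (fun x => (γ₂ x)⁻¹) Ω := by
    refine (integrableOn_const (C := l₂) hfin).mono'
      h₂.aestronglyMeasurable.aemeasurable.inv.aestronglyMeasurable ?_
    filter_upwards [h₂.bounds] with x hx
    have h0 : 0 < γ₂ x := lt_of_lt_of_le (by positivity) hx.1
    rw [Real.norm_of_nonneg (by positivity), inv_le_comm₀ h0 hl2, ← one_div]
    exact hx.1
  have t2 := (ha₂.inv h₂ hi₂ hbdd ha2pos).tendsto_rescaled_setIntegral hΩ hn hblow hinv hbdd c2 s2
  have t3 := tendsto_rescaled_setIntegral hΩ hn hblow c3 s3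
  -- The multiplier of the rotated gradient is chosen to be `a₂`: as `a₂ ^ 2 * a₂⁻¹ = a₂`, the left
  -- side completes to `a₂` times the difference of squared norms in the conclusion.
  have hle := le_of_tendsto_of_tendsto ((t3.const_mul (2 * a₂)).sub (t2.const_mul (a₂ ^ 2))) t1 (by
    filter_upwards [self_mem_nhdsWithin] with r (hr : 0 < r)
    have h := rescaled_dual_energy_le_energy hd hbdd h₁ h₂ hDtN hV hc hW hcW p q z a₂
      (inv_ne_zero hr.ne')
    have h' := mul_le_mul_of_nonneg_left h (by positivity : 0 ≤ (r ^ d)⁻¹)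
    refine le_trans (le_of_eq ?_) h'
    ring)
  have i1 := (c1.integrable_of_hasCompactSupport s1 (μ := volume)).integrableOn
    (s := {y | 0 < ⟪n, y⟫})
  have i2 := (c2.integrable_of_hasCompactSupport s2 (μ := volume)).integrableOn
    (s := {y | 0 < ⟪n, y⟫})
  have i3 := (c3.integrable_of_hasCompactSupport s3 (μ := volume)).integrableOn
    (s := {y | 0 < ⟪n, y⟫})
  have hexp : ∫ y in {y | 0 < ⟪n, y⟫}, ‖∇ V y - T y‖ ^ 2 =
      (∫ y in {y | 0 < ⟪n, y⟫}, ‖∇ V y‖ ^ 2) - 2 * (∫ y in {y | 0 < ⟪n, y⟫}, ⟪T y, ∇ V y⟫) +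
        ∫ y in {y | 0 < ⟪n, y⟫}, ‖T y‖ ^ 2 := by
    have i4 : IntegrableOn (fun y => ‖∇ V y‖ ^ 2 - 2 * ⟪T y, ∇ V y⟫) {y | 0 < ⟪n, y⟫} :=
      i1.sub (i3.const_mul 2)
    rw [← integral_const_mul, ← integral_sub i1 (i3.const_mul 2), ← integral_add i4 i2]
    congr 1
    ext y
    rw [norm_sub_sq_real, real_inner_comm]
  rw [hexp]
  refine le_trans (le_of_eq ?_) hle
  field_simp
  ring

end Comparison

/-! ### Truncated harmonic conjugates in a half-space. -/

section Oscillating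

/-- If every `R` failed, each doubling of a sufficiently large `R` would multiply `m` by at least `2
^ (k + 1)`, contradicting growth of order `R ^ k`. It selects a cut-off radius without computing
`m`. -/
lemma exists_mul_two_le_of_le_pow {m : ℝ → ℝ} {K : ℝ} {k : ℕ} (hpos : ∀ R > 0, 0 < m R)
    (hK : ∀ R > 0, m R ≤ K * R ^ k) {c : ℝ} (hc : 0 < c) :
    ∃ R > 0, m (2 * R) ≤ c * R ^ 2 * m R := by
  by_contra! h
  -- From the scale `2 ^ J` on, the factor `c * R ^ 2` exceeds `2 ^ (k + 1)`.
  obtain ⟨J, hJ⟩ := pow_unbounded_of_one_lt (2 ^ (k + 1) / c) (by norm_num : (1 : ℝ) < 4)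
  rw [div_lt_iff₀ hc] at hJ
  have hstep : ∀ j : ℕ, 2 ^ (k + 1) * m (2 ^ (J + j)) ≤ m (2 ^ (J + (j + 1))) := fun j => by
    have h1 := h (2 ^ (J + j)) (by positivity)
    have h2 : (2 : ℝ) ^ (J + (j + 1)) = 2 * 2 ^ (J + j) := by ring
    rw [h2]
    refine le_trans ?_ h1.le
    have h3 := hpos (2 ^ (J + j)) (by positivity)
    gcongr
    have h4 : ((2 : ℝ) ^ (J + j)) ^ 2 = 4 ^ J * 4 ^ j := by
      rw [← pow_mul, mul_comm, pow_mul, ← pow_add]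
      norm_num
    rw [h4]
    have h5 : (1 : ℝ) ≤ 4 ^ j := one_le_pow₀ (by norm_num)
    nlinarith [mul_pos hc (by positivity : (0 : ℝ) < 4 ^ J)]
  have hind : ∀ j : ℕ, (2 ^ (k + 1)) ^ j * m (2 ^ J) ≤ m (2 ^ (J + j)) := fun j => by
    induction j with
    | zero => simp
    | succ j ih =>
      refine le_trans ?_ (hstep j)
      rw [pow_succ', mul_assoc]
      gcongr
  have hJpos := hpos (2 ^ J) (by positivity)
  -- After `i` further doublings the lower bound exceeds the polynomial upper bound by a factor of
  -- order `2 ^ i`.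
  obtain ⟨i, hi⟩ := pow_unbounded_of_one_lt (K * (2 ^ J) ^ k / m (2 ^ J))
    (by norm_num : (1 : ℝ) < 2)
  rw [div_lt_iff₀ hJpos] at hi
  have h1 := (hind i).trans (hK (2 ^ (J + i)) (by positivity))
  have h2 : ((2 : ℝ) ^ (k + 1)) ^ i * m (2 ^ J) = (2 ^ i * m (2 ^ J)) * (2 ^ k) ^ i := by
    rw [pow_succ, mul_pow]
    ring
  have h3 : K * ((2 : ℝ) ^ (J + i)) ^ k = (K * (2 ^ J) ^ k) * (2 ^ k) ^ i := by
    rw [pow_add, mul_pow, ← pow_mul 2 i k, ← pow_mul 2 k i, mul_comm i k]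
    ring
  rw [h2, h3] at h1
  exact absurd (le_of_mul_le_mul_right h1 (by positivity)) (not_le.2 hi)

lemma hasFDerivAt_inner_left {E : Type*} [NormedAddCommGroup E] [InnerProductSpace ℝ E]
    (n x : E) : HasFDerivAt (fun y => ⟪n, y⟫) (innerSL ℝ n) x :=
  (innerSL ℝ n).hasFDerivAt

variable {E : Type*} [NormedAddCommGroup E] [InnerProductSpace ℝ E] [FiniteDimensional ℝ E]

lemma gradient_mul {f g : E → ℝ} {x : E} (hf : DifferentiableAt ℝ f x)
    (hg : DifferentiableAt ℝ g x) :
    ∇ (fun y => f y * g y) x = f x • ∇ g x + g x • ∇ f x := by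
  refine ext_inner_right ℝ fun c => ?_
  rw [inner_add_left, real_inner_smul_left, real_inner_smul_left, inner_gradient_left,
    inner_gradient_left, inner_gradient_left, fderiv_fun_mul hf hg]
  simp

lemma gradient_exp_neg_mul_cos (n b x : E) :
    ∇ (fun y => Real.exp (-⟪n, y⟫) * Real.cos ⟪b, y⟫) x =
      -(Real.exp (-⟪n, x⟫) * Real.cos ⟪b, x⟫) • n - (Real.exp (-⟪n, x⟫) * Real.sin ⟪b, x⟫) • b := by
  refine ext_inner_right ℝ fun c => ?_
  have h := ((hasFDerivAt_inner_left n x).fun_neg.exp.mul (hasFDerivAt_inner_left b x).cos).fderiv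
  rw [inner_gradient_left]
  refine (congrArg (fun L => L c) h).trans ?_
  simp only [inner_sub_left, real_inner_smul_left, _root_.add_apply, _root_.smul_apply,
    _root_.neg_apply, innerSL_apply_apply, smul_eq_mul]
  ring

lemma gradient_exp_neg_mul_sin (n b x : E) :
    ∇ (fun y => Real.exp (-⟪n, y⟫) * Real.sin ⟪b, y⟫) x =
      -(Real.exp (-⟪n, x⟫) * Real.sin ⟪b, x⟫) • n + (Real.exp (-⟪n, x⟫) * Real.cos ⟪b, x⟫) • b := by
  refine ext_inner_right ℝ fun c => ?_
  have h := ((hasFDerivAt_inner_left n x).fun_neg.exp.mul (hasFDerivAt_inner_left b x).sin).fderiv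
  rw [inner_gradient_left]
  refine (congrArg (fun L => L c) h).trans ?_
  simp only [inner_add_left, real_inner_smul_left, _root_.add_apply, _root_.smul_apply,
    _root_.neg_apply, innerSL_apply_apply, smul_eq_mul]
  ring

variable [MeasurableSpace E] [BorelSpace E] {μ : Measure E} [μ.IsAddHaarMeasure]

/-- In a half-space, cut-offs of `exp (-⟪n, y⟫) cos ⟪b, y⟫` and of its harmonic conjugate give a
function whose gradient is, up to a small relative error in energy, a rotated gradient. -/
lemma exists_almost_conjugate {n b : E} (hn : ‖n‖ = 1) (hb : ‖b‖ = 1) (hnb : ⟪n, b⟫ = 0) {ε : ℝ}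
    (hε : 0 < ε) : ∃ V W : E → ℝ, ContDiff ℝ ∞ V ∧ HasCompactSupport V ∧ ContDiff ℝ ∞ W ∧
      HasCompactSupport W ∧ 0 < ∫ y in {y | 0 < ⟪n, y⟫}, ‖∇ V y‖ ^ 2 ∂μ ∧
      ∫ y in {y | 0 < ⟪n, y⟫}, ‖∇ V y - rotatedGradient W n b y‖ ^ 2 ∂μ ≤
        ε * ∫ y in {y | 0 < ⟪n, y⟫}, ‖∇ V y‖ ^ 2 ∂μ := by
  set H : Set E := {y | 0 < ⟪n, y⟫} with hH
  have hHo : IsOpen H := isOpen_lt (by fun_prop) (by fun_prop)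
  set w : E → ℝ := fun y => Real.exp (-⟪n, y⟫) with hw
  have hwc : Continuous w := by fun_prop
  have hw1 : ∀ y ∈ H, w y ≤ 1 := fun y hy => Real.exp_le_one_iff.2 (neg_nonpos.2 (le_of_lt hy))
  -- Since `w` is the norm of the gradient of the untruncated function `A` below, `m R` is the
  -- energy of `A` in the half ball of radius `R`.
  set m : ℝ → ℝ := fun R => ∫ y in H ∩ closedBall 0 R, w y ^ 2 ∂μ with hm
  have hmi : ∀ R, IntegrableOn (fun y => w y ^ 2) (H ∩ closedBall 0 R) μ := fun R =>
    ((by fun_prop : Continuous fun y => w y ^ 2).continuousOn.integrableOn_compact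
      (isCompact_closedBall 0 R)).mono_set Set.inter_subset_right
  have hmpos : ∀ R > 0, 0 < m R := by
    intro R hR
    rw [hm, setIntegral_pos_iff_support_of_nonneg_ae (Eventually.of_forall fun y => sq_nonneg _)
      (hmi R)]
    have hsub : H ∩ ball 0 R ⊆ Function.support (fun y => w y ^ 2) ∩ (H ∩ closedBall 0 R) :=
      fun y hy => ⟨(pow_pos (Real.exp_pos _) 2).ne', hy.1, ball_subset_closedBall hy.2⟩
    refine lt_of_lt_of_le ((hHo.inter isOpen_ball).measure_pos μ ⟨(R / 2) • n, ?_, ?_⟩)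
      (measure_mono hsub)
    · simp [hH, inner_smul_right, hn, hR]
    · rw [mem_ball_zero_iff, norm_smul, hn, mul_one, Real.norm_of_nonneg (by positivity)]
      linarith
  have hmle : ∀ R > 0, m R ≤ μ.real (closedBall 0 1) * R ^ (Module.finrank ℝ E) := by
    intro R hR
    calc m R ≤ ∫ y in H ∩ closedBall 0 R, (1 : ℝ) ∂μ := by
          refine setIntegral_mono_on (hmi R) (integrableOn_const (ne_top_of_le_ne_top
            measure_closedBall_lt_top.ne (measure_mono Set.inter_subset_right)))
            (hHo.measurableSet.inter measurableSet_closedBall) fun y hy => ?_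
          exact pow_le_one₀ (Real.exp_pos _).le (hw1 y hy.1)
      _ = μ.real (H ∩ closedBall 0 R) := by simp
      _ ≤ μ.real (closedBall 0 R) := measureReal_mono Set.inter_subset_right
          measure_closedBall_lt_top.ne
      _ = _ := by
        rw [measureReal_def, Measure.addHaar_closedBall' _ _ hR.le, ENNReal.toReal_mul,
          ENNReal.toReal_ofReal (by positivity), measureReal_def, mul_comm]
  -- the cut-off
  let χ₀ : ContDiffBump (0 : E) := ⟨1, 2, one_pos, one_lt_two⟩
  have hχ₀ : ContDiff ℝ ∞ χ₀ := χ₀.contDiff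
  obtain ⟨C, hC⟩ := χ₀.hasCompactSupport.gradient.exists_bound_of_continuous
    (hχ₀.continuous_gradient (by simp))
  have hC0 : 0 ≤ C := (norm_nonneg _).trans (hC 0)
  -- The bound `1 / 4` yields `m R ≤ 4 * Q` below; `36` is this `4` times the `9` from squaring the
  -- factor `3` in `hdiff`.
  set δ : ℝ := min (1 / 4) (ε / 36) with hδ
  have hδ0 : 0 < δ := by positivity
  -- The cut-off at radius `R` has gradient at most `C / R` and lives in the ball of radius `2 * R`,
  -- so its cost is `(C / R) ^ 2 * m (2 * R)`. The radius is chosen to make this small compared with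
  -- `m R`.
  obtain ⟨R, hR, hmR⟩ := exists_mul_two_le_of_le_pow hmpos hmle
    (c := δ / (C ^ 2 + 1)) (by positivity)
  have hmR' : (C / R) ^ 2 * m (2 * R) ≤ δ * m R := by
    have h0 := hmpos R hR
    calc (C / R) ^ 2 * m (2 * R) ≤ (C / R) ^ 2 * (δ / (C ^ 2 + 1) * R ^ 2 * m R) := by gcongr
      _ = C ^ 2 / (C ^ 2 + 1) * (δ * m R) := by field_simp
      _ ≤ 1 * (δ * m R) := by
        gcongr
        rw [div_le_one (by positivity)]
        linarith
      _ = _ := one_mul _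
  set χ : E → ℝ := fun y => χ₀ (R⁻¹ • (y - 0)) with hχ
  have hχs : ContDiff ℝ ∞ χ := hχ₀.comp (by fun_prop)
  have hχc : HasCompactSupport χ := χ₀.hasCompactSupport.comp_rescale 0 (inv_ne_zero hR.ne')
  have hχg : ∀ y, ‖∇ χ y‖ ≤ C / R := fun y => by
    rw [hχ, gradient_comp_rescale (hχ₀.differentiable (by simp)), norm_smul, norm_inv,
      Real.norm_of_nonneg hR.le, div_eq_inv_mul]
    gcongr
    exact hC _
  have hχg0 : ∀ y, y ∉ closedBall (0 : E) (2 * R) → ∇ χ y = 0 := fun y hy => by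
    rw [hχ, gradient_comp_rescale (hχ₀.differentiable (by simp)),
      gradient_eq_zero_of_notMem_tsupport, smul_zero]
    rw [χ₀.tsupport_eq, mem_closedBall_zero_iff, norm_smul, norm_inv, Real.norm_of_nonneg hR.le,
      sub_zero, inv_mul_le_iff₀ hR, mul_comm]
    rwa [mem_closedBall_zero_iff] at hy
  have hχ1 : ∀ y ∈ closedBall (0 : E) R, χ y = 1 := fun y hy => by
    refine χ₀.one_of_mem_closedBall ?_
    rw [mem_closedBall_zero_iff, norm_smul, norm_inv, Real.norm_of_nonneg hR.le,
      sub_zero, inv_mul_le_iff₀ hR]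
    change _ ≤ R * 1
    simpa using hy
  set A : E → ℝ := fun y => Real.exp (-⟪n, y⟫) * Real.cos ⟪b, y⟫ with hA
  set B : E → ℝ := fun y => Real.exp (-⟪n, y⟫) * Real.sin ⟪b, y⟫ with hB
  have hin : ∀ c : E, ContDiff ℝ ∞ (fun y : E => ⟪c, y⟫) := fun c =>
    contDiff_const.inner ℝ contDiff_id
  have hAs : ContDiff ℝ ∞ A := (hin n).neg.exp.mul (hin b).cos
  have hBs : ContDiff ℝ ∞ B := (hin n).neg.exp.mul (hin b).sin
  have hbn : ⟪b, n⟫ = 0 := by rw [real_inner_comm, hnb]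
  have hnn : ⟪n, n⟫ = 1 := by rw [real_inner_self_eq_norm_sq, hn, one_pow]
  have hbb : ⟪b, b⟫ = 1 := by rw [real_inner_self_eq_norm_sq, hb, one_pow]
  have hAabs : ∀ y, |A y| ≤ w y := fun y => by
    rw [hA, abs_mul, abs_of_pos (Real.exp_pos _)]
    exact mul_le_of_le_one_right (Real.exp_pos _).le (Real.abs_cos_le_one _)
  have hBabs : ∀ y, |B y| ≤ w y := fun y => by
    rw [hB, abs_mul, abs_of_pos (Real.exp_pos _)]
    exact mul_le_of_le_one_right (Real.exp_pos _).le (Real.abs_sin_le_one _)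
  have hgA : ∀ y, ‖∇ A y‖ = w y := fun y => by
    have h : ‖∇ A y‖ ^ 2 = w y ^ 2 := by
      rw [hA, gradient_exp_neg_mul_cos, ← real_inner_self_eq_norm_sq]
      simp only [inner_sub_left, inner_sub_right, real_inner_smul_left, inner_smul_right, hnn, hbb,
        hnb, hbn]
      linear_combination w y ^ 2 * Real.sin_sq_add_cos_sq ⟪b, y⟫
    exact (sq_eq_sq₀ (norm_nonneg _) (Real.exp_pos _).le).1 h
  have dχ : ∀ y, DifferentiableAt ℝ χ y := hχs.differentiable (by simp)
  have dA : ∀ y, DifferentiableAt ℝ A y := hAs.differentiable (by simp)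
  have dB : ∀ y, DifferentiableAt ℝ B y := hBs.differentiable (by simp)
  have hgV : ∀ y, ∇ (fun y => χ y * A y) y = χ y • ∇ A y + A y • ∇ χ y := fun y =>
    gradient_mul (dχ y) (dA y)
  have hdiff : ∀ y, ‖∇ (fun y => χ y * A y) y - rotatedGradient (fun y => χ y * B y) n b y‖ ≤
      3 * (w y * ‖∇ χ y‖) := fun y => by
    -- The terms containing `χ` itself cancel, because `∇ A` is the rotated gradient of `B`; only
    -- derivatives of the cut-off remain.
    have e : ∇ (fun y => χ y * A y) y - rotatedGradient (fun y => χ y * B y) n b y =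
        A y • ∇ χ y - B y • (⟪∇ χ y, n⟫ • b - ⟪∇ χ y, b⟫ • n) := by
      rw [hgV, rotatedGradient, gradient_mul (dχ y) (dB y)]
      simp only [hA, hB, gradient_exp_neg_mul_cos, gradient_exp_neg_mul_sin, inner_add_left,
        real_inner_smul_left, hnn, hbb, hnb, hbn]
      module
    rw [e]
    have h1 : ‖⟪∇ χ y, n⟫ • b - ⟪∇ χ y, b⟫ • n‖ ≤ 2 * ‖∇ χ y‖ := by
      refine (norm_sub_le _ _).trans ?_
      rw [norm_smul, norm_smul, hn, hb, Real.norm_eq_abs, Real.norm_eq_abs]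
      have k1 := abs_real_inner_le_norm (∇ χ y) n
      have k2 := abs_real_inner_le_norm (∇ χ y) b
      rw [hn] at k1
      rw [hb] at k2
      linarith
    calc _ ≤ ‖A y • ∇ χ y‖ + ‖B y • (⟪∇ χ y, n⟫ • b - ⟪∇ χ y, b⟫ • n)‖ := norm_sub_le _ _
      _ ≤ w y * ‖∇ χ y‖ + w y * (2 * ‖∇ χ y‖) := by
        rw [norm_smul, norm_smul, Real.norm_eq_abs, Real.norm_eq_abs]
        have k1 := hAabs y
        have k2 := hBabs y
        have k3 : 0 ≤ w y := (Real.exp_pos _).le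
        gcongr
      _ = _ := by ring
  have hVs : ContDiff ℝ ∞ (fun y => χ y * A y) := hχs.mul hAs
  have hWs : ContDiff ℝ ∞ (fun y => χ y * B y) := hχs.mul hBs
  have hVc : HasCompactSupport (fun y => χ y * A y) := hχc.mul_right
  have hWc : HasCompactSupport (fun y => χ y * B y) := hχc.mul_right
  have cV := hVs.continuous_gradient (by simp)
  have cT := hWs.continuous_rotatedGradient n b
  have cχ := hχs.continuous_gradient (by simp)
  have cχ' := hχs.continuous
  have iχ : Integrable (fun y => (w y * ‖∇ χ y‖) ^ 2) μ :=
    Continuous.integrable_of_hasCompactSupport (by fun_prop) (by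
      refine hχc.gradient.mono fun y hy => ?_
      contrapose! hy
      simp only [Function.mem_support, not_not] at hy ⊢
      simp [hy])
  have iV : Integrable (fun y => ‖∇ (fun y => χ y * A y) y‖ ^ 2) μ :=
    Continuous.integrable_of_hasCompactSupport (by fun_prop)
      (hVc.gradient.comp_left (g := fun y => ‖y‖ ^ 2) (by simp))
  have iw : Integrable (fun y => (χ y * w y) ^ 2) μ :=
    Continuous.integrable_of_hasCompactSupport (by fun_prop)
      (hχc.mul_right.comp_left (g := fun y => y ^ 2) (by simp))
  have hEχ : ∫ y in H, (w y * ‖∇ χ y‖) ^ 2 ∂μ ≤ δ * m R := by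
    refine le_trans ?_ hmR'
    rw [hm, ← integral_const_mul, ← integral_indicator hHo.measurableSet,
      ← integral_indicator (hHo.measurableSet.inter measurableSet_closedBall)]
    refine integral_mono (iχ.indicator hHo.measurableSet)
      (IntegrableOn.integrable_indicator ((hmi _).const_mul _)
        (hHo.measurableSet.inter measurableSet_closedBall)) fun y => ?_
    by_cases hy : y ∈ H ∩ closedBall 0 (2 * R)
    · rw [Set.indicator_of_mem hy, Set.indicator_of_mem hy.1, mul_pow, mul_comm]
      have := hχg y
      gcongr
    · rw [Set.indicator_of_notMem hy]
      by_cases hyH : y ∈ H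
      · rw [Set.indicator_of_mem hyH, hχg0 y fun h => hy ⟨hyH, h⟩]
        simp
      · rw [Set.indicator_of_notMem hyH]
  set Q := ∫ y in H, ‖∇ (fun y => χ y * A y) y‖ ^ 2 ∂μ with hQ
  -- Lower bound for the truncated energy: on the ball of radius `R` the cut-off is `1`, and `χ ∇A =
  -- ∇(χ A) - A ∇χ` with `|A| ≤ w`.
  have hmQ : m R ≤ 2 * Q + 2 * (δ * m R) := by
    calc m R = ∫ y in H ∩ closedBall 0 R, (χ y * w y) ^ 2 ∂μ := by
          refine setIntegral_congr_fun (hHo.measurableSet.inter measurableSet_closedBall)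
            fun y hy => ?_
          simp only [hχ1 y hy.2, one_mul]
      _ ≤ ∫ y in H, (χ y * w y) ^ 2 ∂μ :=
          setIntegral_mono_set iw.integrableOn (Eventually.of_forall fun y => sq_nonneg _)
            (LE.le.eventuallyLE Set.inter_subset_left)
      _ ≤ ∫ y in H, (2 * ‖∇ (fun y => χ y * A y) y‖ ^ 2 + 2 * (w y * ‖∇ χ y‖) ^ 2) ∂μ := by
          refine integral_mono iw.integrableOn
            ((iV.integrableOn.const_mul 2).add (iχ.integrableOn.const_mul 2)) fun y => ?_
          have h1 : |χ y * w y| ≤ ‖∇ (fun y => χ y * A y) y‖ + w y * ‖∇ χ y‖ := by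
            have e1 : χ y • ∇ A y = ∇ (fun y => χ y * A y) y - A y • ∇ χ y := by
              rw [hgV, add_sub_cancel_right]
            have e2 : |χ y * w y| = ‖χ y • ∇ A y‖ := by
              rw [norm_smul, hgA, abs_mul, Real.norm_eq_abs, abs_of_pos (Real.exp_pos _ : 0 < w y)]
            rw [e2, e1]
            refine (norm_sub_le _ _).trans ?_
            rw [norm_smul, Real.norm_eq_abs]
            have := hAabs y
            gcongr
          have h2 := pow_le_pow_left₀ (abs_nonneg _) h1 2
          rw [sq_abs] at h2
          simp only
          nlinarith [sq_nonneg (‖∇ (fun y => χ y * A y) y‖ - w y * ‖∇ χ y‖)]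
      _ = 2 * Q + 2 * ∫ y in H, (w y * ‖∇ χ y‖) ^ 2 ∂μ := by
          rw [integral_add (iV.integrableOn.const_mul 2) (iχ.integrableOn.const_mul 2),
            integral_const_mul, integral_const_mul]
      _ ≤ _ := by gcongr
  have hδ1 : δ ≤ 1 / 4 := min_le_left _ _
  have hδ2 : δ ≤ ε / 36 := min_le_right _ _
  have hmRpos := hmpos R hR
  have hmQ' : m R ≤ 4 * Q := by nlinarith
  refine ⟨_, _, hVs, hVc, hWs, hWc, by linarith, ?_⟩
  calc ∫ y in H, ‖∇ (fun y => χ y * A y) y - rotatedGradient (fun y => χ y * B y) n b y‖ ^ 2 ∂μ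
      ≤ ∫ y in H, 9 * (w y * ‖∇ χ y‖) ^ 2 ∂μ := by
        refine integral_mono_of_nonneg (Eventually.of_forall fun y => sq_nonneg _)
          (iχ.integrableOn.const_mul 9) (Eventually.of_forall fun y => ?_)
        have := pow_le_pow_left₀ (norm_nonneg _) (hdiff y) 2
        simp only
        linarith
    _ = 9 * ∫ y in H, (w y * ‖∇ χ y‖) ^ 2 ∂μ := integral_const_mul _ _
    _ ≤ 9 * (δ * m R) := by gcongr
    _ ≤ 9 * (ε / 36 * (4 * Q)) := by gcongr
    _ = ε * Q := by ring

end Oscillating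

/-! ### The fundamental theorem of calculus for weak directional derivatives. -/

section WeakDerivative

variable {E : Type*} [NormedAddCommGroup E] [NormedSpace ℝ E]

/-- Compactness of the parameter interval, as in the tube lemma. On this open set the segment
formula can be tested with smooth functions. -/
lemma isOpen_setOf_segment_subset {Ω : Set E} (hΩ : IsOpen Ω) (e : E) (s : ℝ) :
    IsOpen {x | ∀ τ ∈ Set.Icc (0 : ℝ) s, x + τ • e ∈ Ω} := by
  refine isOpen_iff_mem_nhds.2 fun x hx => ?_
  refine isCompact_Icc.eventually_forall_of_forall_eventually fun τ hτ => ?_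
  have hc : Continuous fun p : E × ℝ => p.1 + p.2 • e := by fun_prop
  exact (hc.tendsto (x, τ)).eventually_mem (hΩ.mem_nhds (hx τ hτ))

variable [FiniteDimensional ℝ E] [MeasurableSpace E] [BorelSpace E] {μ : Measure E}
  [μ.IsAddHaarMeasure]

/-- The shear `(τ, x) ↦ (τ, x + τ • e)` preserves the product measure by translation invariance. -/
lemma Integrable.comp_add_smul {g : E → ℝ} (hg : Integrable g μ) (e : E) (s : Set ℝ)
    [IsFiniteMeasure (volume.restrict s)] :
    Integrable (fun p : ℝ × E => g (p.2 + p.1 • e)) ((volume.restrict s).prod μ) := by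
  have hmp : MeasurePreserving (fun p : ℝ × E => (id p.1, p.2 + p.1 • e))
      ((volume.restrict s).prod μ) ((volume.restrict s).prod μ) :=
    (MeasurePreserving.id _).skew_product (g := fun τ x => x + τ • e) (by fun_prop)
      (Eventually.of_forall fun τ => map_add_right_eq_self μ (τ • e))
  exact hmp.integrable_comp_of_integrable (hg.comp_snd (volume.restrict s))

/-- If `g` is the weak derivative of `u` in the direction `e`, then `u` is for almost every base
point the integral of `g` along segments of a given length in the direction `e`. -/
lemma ae_sub_eq_setIntegral_of_weak_lineDeriv {Ω : Set E} (hΩ : IsOpen Ω) {u g : E → ℝ}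
    (hu : Integrable u μ) (hg : Integrable g μ) {e : E}
    (hw : ∀ φ : E → ℝ, ContDiff ℝ ∞ φ → HasCompactSupport φ → tsupport φ ⊆ Ω →
      ∫ x, u x * fderiv ℝ φ x e ∂μ = -∫ x, φ x * g x ∂μ) {s : ℝ} (hs : 0 ≤ s) :
    ∀ᵐ x ∂μ, (∀ τ ∈ Set.Icc (0 : ℝ) s, x + τ • e ∈ Ω) →
      u (x + s • e) - u x = ∫ τ in Set.Ioc 0 s, g (x + τ • e) := by
  have hJ : Integrable (fun x => ∫ τ in Set.Ioc 0 s, g (x + τ • e)) μ :=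
    (Integrable.comp_add_smul hg e (Set.Ioc 0 s)).integral_prod_right
  have hus : Integrable (fun x => u (x + s • e)) μ := hu.comp_add_right (s • e)
  have hf : Integrable (fun x => u (x + s • e) - u x - ∫ τ in Set.Ioc 0 s, g (x + τ • e)) μ :=
    (hus.sub hu).sub hJ
  -- If `φ` is supported where whole segments lie in `Ω`, then all translates `φ (· - τ • e)` with
  -- `0 < τ ≤ s` are admissible test functions in `Ω`.
  have key := (isOpen_setOf_segment_subset hΩ e s).ae_eq_zero_of_integral_contDiff_smul_eq_zero
    (hf.locallyIntegrable.locallyIntegrableOn _) (fun φ hφ hc hsupp => ?_)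
  · filter_upwards [key] with x hx h
    exact sub_eq_zero.1 (hx h)
  obtain ⟨M, hM⟩ := hc.exists_bound_of_continuous hφ.continuous
  have hφ' : Continuous (fun x => fderiv ℝ φ x e) :=
    (hφ.continuous_fderiv (by simp)).clm_apply continuous_const
  have hc' : HasCompactSupport (fun x => fderiv ℝ φ x e) :=
    HasCompactSupport.comp_left (g := fun L : E →L[ℝ] ℝ => L e) (hc.fderiv ℝ) (by simp)
  obtain ⟨M', hM'⟩ := hc'.exists_bound_of_continuous hφ'
  have hφc := hφ.continuous
  have hmul : ∀ {v : E → ℝ}, Integrable v μ → Integrable (fun x => φ x * v x) μ := fun hv =>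
    hv.bdd_mul hφc.aestronglyMeasurable (Eventually.of_forall hM)
  have hshift : ∀ (τ : ℝ) (v : E → ℝ),
      ∫ x, φ x * v (x + τ • e) ∂μ = ∫ x, φ (x - τ • e) * v x ∂μ := fun τ v => by
    rw [← integral_sub_right_eq_self (fun x => φ x * v (x + τ • e)) (τ • e)]
    simp only [sub_add_cancel]
  have hweak : ∀ τ ∈ Set.Ioc 0 s, ∫ x, φ x * g (x + τ • e) ∂μ =
      -∫ x, u x * fderiv ℝ φ (x - τ • e) e ∂μ := fun τ hτ => by
    have h1 : ContDiff ℝ ∞ (fun x => φ (x - τ • e)) := hφ.comp (by fun_prop)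
    have h2 : HasCompactSupport (fun x => φ (x - τ • e)) :=
      hc.comp_homeomorph (Homeomorph.subRight (τ • e))
    have h3 : tsupport (fun x => φ (x - τ • e)) ⊆ Ω := fun x hx => by
      have h4 : x - τ • e ∈ tsupport φ :=
        tsupport_comp_subset_preimage φ (f := fun x => x - τ • e) (by fun_prop) hx
      have := hsupp h4 τ ⟨hτ.1.le, hτ.2⟩
      rwa [sub_add_cancel] at this
    rw [hshift, ← neg_eq_iff_eq_neg.2 (hw _ h1 h2 h3)]
    simp only [fderiv_comp_sub]
  have hftc : ∀ x, ∫ τ in Set.Ioc 0 s, fderiv ℝ φ (x - τ • e) e = φ x - φ (x - s • e) := fun x => by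
    have hd : ∀ τ ∈ Set.uIcc 0 s, HasDerivAt (fun τ : ℝ => -φ (x - τ • e))
        (fderiv ℝ φ (x - τ • e) e) τ := fun τ _ => by
      have h1 : HasDerivAt (fun τ : ℝ => x - τ • e) (-e) τ := by
        simpa using ((hasDerivAt_id τ).smul_const e).const_sub x
      have h2 : HasDerivAt (fun τ : ℝ => -φ (x - τ • e)) (-(fderiv ℝ φ (x - τ • e) (-e))) τ :=
        ((hφ.differentiable (by simp) (x - τ • e)).hasFDerivAt.comp_hasDerivAt τ h1).neg
      simpa using h2
    rw [← intervalIntegral.integral_of_le hs, intervalIntegral.integral_eq_sub_of_hasDerivAt hd]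
    · simp only [zero_smul, sub_zero]
      ring
    · exact (hφ'.comp (by fun_prop : Continuous fun τ : ℝ => x - τ • e)).intervalIntegrable _ _
  have i1 : Integrable (Function.uncurry fun (x : E) (τ : ℝ) => φ x * g (x + τ • e))
      (μ.prod (volume.restrict (Set.Ioc 0 s))) :=
    ((Integrable.comp_add_smul hg e (Set.Ioc 0 s)).bdd_mul (f := fun p : ℝ × E => φ p.2) (c := M)
      (hφc.comp continuous_snd).aestronglyMeasurable
      (Eventually.of_forall fun p => hM p.2)).swap
  have i2 : Integrable (Function.uncurry fun (τ : ℝ) (x : E) => u x * fderiv ℝ φ (x - τ • e) e)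
      ((volume.restrict (Set.Ioc 0 s)).prod μ) :=
    (hu.comp_snd (volume.restrict (Set.Ioc 0 s))).mul_bdd (c := M')
      (hφ'.comp (by fun_prop : Continuous fun p : ℝ × E => p.2 - p.1 • e)).aestronglyMeasurable
      (Eventually.of_forall fun p => hM' _)
  -- Fubini puts the integral over `τ` outside, the weak derivative moves onto the translate of `φ`,
  -- and integrating in `τ` gives the increment of `φ` by `hftc`.
  have hJcalc : ∫ x, φ x * (∫ τ in Set.Ioc 0 s, g (x + τ • e)) ∂μ =
      -∫ x, u x * (φ x - φ (x - s • e)) ∂μ := by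
    simp only [← hftc, ← integral_const_mul]
    rw [integral_integral_swap i1, ← integral_integral_swap i2, ← integral_neg]
    exact setIntegral_congr_fun measurableSet_Ioc hweak
  have i3 : Integrable (fun x => φ x * u (x + s • e) - φ x * u x) μ := (hmul hus).sub (hmul hu)
  simp only [smul_eq_mul, mul_sub]
  rw [integral_sub i3 (hmul hJ), integral_sub (hmul hus) (hmul hu), hJcalc,
    hshift]
  have hus' : Integrable (fun x => u x * φ (x - s • e)) μ :=
    hu.mul_bdd (c := M) (hφc.comp (by fun_prop)).aestronglyMeasurable
      (Eventually.of_forall fun x => hM _)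
  have hu' : Integrable (fun x => u x * φ x) μ :=
    hu.mul_bdd (c := M) hφc.aestronglyMeasurable (Eventually.of_forall hM)
  simp only [mul_sub]
  rw [integral_sub hu' hus']
  simp only [mul_comm (u _)]
  ring

end WeakDerivative

/-! ### Traces on the fibres of a product. -/

section FibreTrace

variable {X : Type*} [MeasurableSpace X] {ν : Measure X} [SFinite ν]

lemma Integrable.restrict_snd {U : X × ℝ → ℝ} (hU : Integrable U (ν.prod volume)) (s : Set ℝ) :
    Integrable U (ν.prod (volume.restrict s)) := by
  have h := hU.integrableOn (s := Set.univ ×ˢ s)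
  rwa [IntegrableOn, ← Measure.prod_restrict, Measure.restrict_univ] at h

/-- A function on a product whose increments in the second variable are integrals of `g` has, on
almost every fibre, a limit at `0` which is attained with a rate given by `g`. -/
lemma exists_fibre_trace {U g : X × ℝ → ℝ} (hUm : StronglyMeasurable U)
    (hU : Integrable U (ν.prod volume)) (hgm : StronglyMeasurable g)
    (hg : Integrable g (ν.prod volume)) {A : Set X} (hA : MeasurableSet A) {h : ℝ} (hh : 0 < h)
    (hinc : ∀ s, 0 ≤ s → ∀ᵐ p ∂(ν.prod volume), p.1 ∈ A → 0 < p.2 → p.2 + s < h →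
      U (p.1, p.2 + s) - U p = ∫ τ in Set.Ioc p.2 (p.2 + s), g (p.1, τ)) :
    ∃ f : X → ℝ, Integrable f ν ∧ ∀ᵐ x ∂ν, x ∈ A → ∀ᵐ t : ℝ, 0 < t → t < h / 2 →
      |U (x, t) - f x| ≤ ∫ τ in Set.Ioc 0 t, |g (x, τ)| := by
  set I : X × ℝ → ℝ := fun p => ∫ τ in Set.Ioc 0 p.2, g (p.1, τ) with hI
  have hIm : StronglyMeasurable I := by
    have hset : MeasurableSet {q : (X × ℝ) × ℝ | 0 < q.2 ∧ q.2 ≤ q.1.2} :=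
      (measurableSet_lt measurable_const measurable_snd).inter
        (measurableSet_le measurable_snd (measurable_snd.comp measurable_fst))
    have h1 : StronglyMeasurable ({q : (X × ℝ) × ℝ | 0 < q.2 ∧ q.2 ≤ q.1.2}.indicator
        fun q => g (q.1.1, q.2)) :=
      (hgm.comp_measurable (by fun_prop : Measurable fun q : (X × ℝ) × ℝ => (q.1.1, q.2))).indicator
        hset
    have h2 := h1.integral_prod_right' (ν := volume)
    have h3 : I = fun p => ∫ τ, {q : (X × ℝ) × ℝ | 0 < q.2 ∧ q.2 ≤ q.1.2}.indicator
        (fun q => g (q.1.1, q.2)) (p, τ) := by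
      ext p
      exact (integral_indicator (f := fun τ => g (p.1, τ)) measurableSet_Ioc).symm
    rw [h3]
    exact h2
  have hIle : ∀ᵐ x ∂ν, Integrable (fun τ => g (x, τ)) := hg.prod_right_ae
  -- Subtracting the primitive of `g` leaves a function with vanishing increments, hence constant
  -- almost everywhere along each relevant fibre.
  set W : X × ℝ → ℝ := fun p => U p - I p with hW
  have hWm : StronglyMeasurable W := hUm.sub hIm
  have hWinc : ∀ s, 0 ≤ s → ∀ᵐ p ∂(ν.prod volume), p.1 ∈ A → 0 < p.2 → p.2 + s < h →
      W (p.1, p.2 + s) = W p := by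
    intro s hs
    filter_upwards [hinc s hs, Measure.quasiMeasurePreserving_fst.ae hIle] with p hp hgp h1 h2 h3
    have hsplit : I (p.1, p.2 + s) = I p + ∫ τ in Set.Ioc p.2 (p.2 + s), g (p.1, τ) := by
      simp only [hI]
      rw [← setIntegral_union (Set.Ioc_disjoint_Ioc_of_le le_rfl) measurableSet_Ioc
        hgp.integrableOn hgp.integrableOn, Set.Ioc_union_Ioc_eq_Ioc h2.le (by linarith)]
    have := hp h1 h2 h3
    simp only [hW, hsplit]
    linarith
  -- Joint measurability is what permits exchanging "for each `s`, almost every `p`" for "for almost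
  -- every `p`, almost every `s`".
  have hPm : MeasurableSet {q : (X × ℝ) × ℝ | q.1.1 ∈ A → 0 < q.1.2 → 0 ≤ q.2 → q.1.2 + q.2 < h →
      W (q.1.1, q.1.2 + q.2) = W q.1} := by
    have m1 : MeasurableSet {q : (X × ℝ) × ℝ | W (q.1.1, q.1.2 + q.2) = W q.1} :=
      measurableSet_eq_fun (hWm.measurable.comp (by fun_prop)) (hWm.measurable.comp measurable_fst)
    have m2 : MeasurableSet {q : (X × ℝ) × ℝ | q.1.1 ∈ A} :=
      (measurable_fst.comp measurable_fst) hA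
    have m3 : MeasurableSet {q : (X × ℝ) × ℝ | 0 < q.1.2} :=
      measurableSet_lt measurable_const (by fun_prop)
    have m4 : MeasurableSet {q : (X × ℝ) × ℝ | 0 ≤ q.2} :=
      measurableSet_le measurable_const (by fun_prop)
    have m5 : MeasurableSet {q : (X × ℝ) × ℝ | q.1.2 + q.2 < h} :=
      measurableSet_lt (by fun_prop) measurable_const
    refine MeasurableSet.congr ((m2.inter (m3.inter (m4.inter m5))).compl.union m1) ?_
    ext q
    simp only [Set.mem_union, Set.mem_compl_iff, Set.mem_inter_iff, Set.mem_ofPred_eq]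
    tauto
  have hP : ∀ᵐ p ∂(ν.prod volume), ∀ᵐ s : ℝ, p.1 ∈ A → 0 < p.2 → 0 ≤ s → p.2 + s < h →
      W (p.1, p.2 + s) = W p := by
    refine (Measure.ae_ae_comm hPm).2 (Eventually.of_forall fun s => ?_)
    by_cases hs : 0 ≤ s
    · filter_upwards [hWinc s hs] with p hp h1 h2 _ h3 using hp h1 h2 h3
    · exact Eventually.of_forall fun p _ _ h3 => absurd h3 hs
  -- The trace is the constant value of `W` on the fibre, written as a mean over `(h / 2, h)` so
  -- that its integrability is visible. Every `t < h / 2` reaches this interval by nonnegative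
  -- increments.
  refine ⟨fun x => (2 / h) * ∫ σ in Set.Ioo (h / 2) h, W (x, σ), ?_, ?_⟩
  · have hN : Integrable (fun x => ∫ τ, ‖g (x, τ)‖) ν := hg.integral_norm_prod_left
    have hIi : Integrable I (ν.prod (volume.restrict (Set.Ioo (h / 2) h))) := by
      refine (hN.comp_fst (volume.restrict (Set.Ioo (h / 2) h))).mono'
        hIm.aestronglyMeasurable ?_
      filter_upwards [Measure.quasiMeasurePreserving_fst.ae hIle] with p hp
      exact (norm_integral_le_integral_norm _).trans
        (setIntegral_le_integral hp.norm (Eventually.of_forall fun τ => norm_nonneg _))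
    exact (((Integrable.restrict_snd hU _).sub hIi).integral_prod_left).const_mul _
  · filter_upwards [Measure.ae_ae_of_ae_prod hP] with x hx hxA
    filter_upwards [hx] with t ht ht0 hth
    have hconst : ∀ᵐ σ : ℝ, σ ∈ Set.Ioo (h / 2) h → W (x, σ) = W (x, t) := by
      have := (measurePreserving_sub_right (volume : Measure ℝ) t).quasiMeasurePreserving.ae ht
      filter_upwards [this] with σ hσ hσ'
      have h1 := hσ hxA ht0 (by linarith [hσ'.1]) (by simpa using hσ'.2)
      simpa using h1
    have hfx : (2 / h) * ∫ σ in Set.Ioo (h / 2) h, W (x, σ) = W (x, t) := by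
      rw [setIntegral_congr_ae measurableSet_Ioo hconst, setIntegral_const, measureReal_def,
        Real.volume_Ioo, ENNReal.toReal_ofReal (by linarith), smul_eq_mul]
      field_simp
      ring
    rw [hfx]
    simp only [hW, hI, sub_sub_cancel]
    simpa only [Real.norm_eq_abs] using
      norm_integral_le_integral_norm (μ := volume.restrict (Set.Ioc 0 t)) fun τ => g (x, τ)

end FibreTrace

/-! ### Lebesgue points and means over thin cylinders. -/

section LebesguePoints

variable {X : Type*} [NormedAddCommGroup X] [NormedSpace ℝ X] [FiniteDimensional ℝ X]
  [MeasurableSpace X] [BorelSpace X] {ν : Measure X} [ν.IsAddHaarMeasure]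

lemma ae_tendsto_average_abs_sub {f : X → ℝ} (hf : Integrable f ν) :
    ∀ᵐ x ∂ν, Tendsto (fun r : ℝ => ⨍ y in closedBall x r, |f y - f x| ∂ν) (𝓝[>] 0) (𝓝 0) := by
  filter_upwards [IsUnifLocDoublingMeasure.ae_tendsto_average_norm_sub ν hf.locallyIntegrable 1]
    with x hx
  refine hx (fun _ => x) id tendsto_id ?_
  filter_upwards [self_mem_nhdsWithin] with r (hr : 0 < r)
  exact mem_closedBall_self (by simpa using hr.le)

/-- The mean of an integrable function over thin cylinders, normalised by the base only, tends to
`0` at almost every base point. -/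
lemma ae_tendsto_average_setIntegral_abs {g : X × ℝ → ℝ} (hg : Integrable g (ν.prod volume))
    (C : ℝ) : ∀ᵐ x ∂ν, Tendsto
      (fun r : ℝ => ⨍ y in closedBall x r, (∫ τ in Set.Ioc 0 (C * r), |g (y, τ)|) ∂ν)
      (𝓝[>] 0) (𝓝 0) := by
  -- The height `C * r` varies with `r`, so Lebesgue differentiation is applied to the countably
  -- many fixed heights `1 / (k + 1)`. Once `C * r` is below such a height, monotonicity bounds the
  -- mean, and `N k x → 0`.
  set N : ℕ → X → ℝ := fun k y => ∫ τ in Set.Ioc (0 : ℝ) (1 / ((k : ℝ) + 1)), |g (y, τ)| with hN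
  have hNi : ∀ k, Integrable (N k) ν := fun k =>
    (Integrable.restrict_snd hg.abs _).integral_prod_left
  have h1 : ∀ᵐ x ∂ν, ∀ k, Tendsto (fun r : ℝ => ⨍ y in closedBall x r, N k y ∂ν) (𝓝[>] 0)
      (𝓝 (N k x)) := by
    rw [ae_all_iff]
    intro k
    filter_upwards [IsUnifLocDoublingMeasure.ae_tendsto_average ν (hNi k).locallyIntegrable 1]
      with x hx
    refine hx (fun _ => x) id tendsto_id ?_
    filter_upwards [self_mem_nhdsWithin] with r (hr : 0 < r)
    exact mem_closedBall_self (by simpa using hr.le)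
  filter_upwards [h1, hg.prod_right_ae] with x hx hgx
  have hN0 : Tendsto (fun k => N k x) atTop (𝓝 0) := by
    have hlim : Tendsto (fun k : ℕ => ∫ τ, (Set.Ioc (0 : ℝ) (1 / ((k : ℝ) + 1))).indicator
        (fun τ => |g (x, τ)|) τ) atTop (𝓝 (∫ _ : ℝ, (0 : ℝ))) := by
      refine tendsto_integral_of_dominated_convergence (fun τ => |g (x, τ)|) (fun k => ?_)
        hgx.abs (fun k => ?_) ?_
      · exact hgx.abs.aestronglyMeasurable.indicator measurableSet_Ioc
      · refine Eventually.of_forall fun τ => ?_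
        refine (norm_indicator_le_norm_self _ _).trans ?_
        simp
      · refine Eventually.of_forall fun τ => tendsto_const_nhds.congr' ?_
        by_cases hτ : 0 < τ
        · have := (tendsto_one_div_add_atTop_nhds_zero_nat (𝕜 := ℝ)).eventually (gt_mem_nhds hτ)
          filter_upwards [this] with k hk
          rw [Set.indicator_of_notMem fun h => absurd h.2 (not_le.2 hk)]
        · refine Eventually.of_forall fun k => ?_
          exact (Set.indicator_of_notMem (fun h => hτ h.1) _).symm
    rw [integral_zero] at hlim
    refine hlim.congr fun k => ?_
    rw [integral_indicator measurableSet_Ioc]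
  rw [Metric.tendsto_nhds]
  intro ε hε
  obtain ⟨k, hk⟩ := (hN0.eventually (gt_mem_nhds hε)).exists
  have hCr : ∀ᶠ r : ℝ in 𝓝[>] 0, C * r < 1 / ((k : ℝ) + 1) := by
    refine nhdsWithin_le_nhds ?_
    have : Tendsto (fun r : ℝ => C * r) (𝓝 0) (𝓝 0) :=
      (by fun_prop : Continuous fun r : ℝ => C * r).tendsto' 0 0 (by simp)
    exact this.eventually (gt_mem_nhds (by positivity))
  filter_upwards [(hx k).eventually (gt_mem_nhds hk), hCr] with r h2 h3
  rw [Real.dist_0_eq_abs, abs_of_nonneg]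
  · refine lt_of_le_of_lt ?_ h2
    rw [setAverage_eq, setAverage_eq, smul_eq_mul, smul_eq_mul]
    refine mul_le_mul_of_nonneg_left ?_ (inv_nonneg.2 measureReal_nonneg)
    refine integral_mono_of_nonneg
      (Eventually.of_forall fun y => integral_nonneg fun τ => abs_nonneg _) (hNi k).integrableOn ?_
    filter_upwards [ae_restrict_of_ae hg.prod_right_ae] with y hy
    exact setIntegral_mono_set hy.abs.integrableOn (Eventually.of_forall fun τ => abs_nonneg _)
      (LE.le.eventuallyLE (Set.Ioc_subset_Ioc_right h3.le))
  · rw [setAverage_eq]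
    exact smul_nonneg (inv_nonneg.2 measureReal_nonneg)
      (integral_nonneg fun y => integral_nonneg fun τ => abs_nonneg _)

end LebesguePoints

/-! ### From fibre traces to means over sets comparable to cylinders. -/

section ProductAverage

variable {X : Type*} [NormedAddCommGroup X] [NormedSpace ℝ X] [FiniteDimensional ℝ X]
  [MeasurableSpace X] [BorelSpace X] {ν : Measure X} [ν.IsAddHaarMeasure]

/-- If `U` has the fibre trace `f` with rate given by `g`, then at a Lebesgue point `x` the means
of `|U - f x|` over sets comparable to cylinders shrinking to `(x, 0)` tend to `0`. -/
lemma tendsto_average_abs_sub_fibre_trace {U g : X × ℝ → ℝ} {f : X → ℝ}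
    (hU : Integrable U (ν.prod volume)) (hg : Integrable g (ν.prod volume)) (hf : Integrable f ν)
    {A : Set X} (hA : IsOpen A) {h : ℝ} (hh : 0 < h)
    (hb : ∀ᵐ x ∂ν, x ∈ A → ∀ᵐ t : ℝ, 0 < t → t < h →
      |U (x, t) - f x| ≤ ∫ τ in Set.Ioc 0 t, |g (x, τ)|)
    {c C : ℝ} (hc : 0 < c) (hC : 0 < C) {x : X} (hx : x ∈ A)
    (hfx : Tendsto (fun r : ℝ => ⨍ y in closedBall x r, |f y - f x| ∂ν) (𝓝[>] 0) (𝓝 0))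
    (hgx : Tendsto (fun r : ℝ => ⨍ y in closedBall x r, (∫ τ in Set.Ioc 0 (C * r), |g (y, τ)|) ∂ν)
      (𝓝[>] 0) (𝓝 0))
    {S : ℝ → Set (X × ℝ)}
    (hS : ∀ᶠ r in 𝓝[>] (0 : ℝ), S r ⊆ closedBall x r ×ˢ Set.Ioc 0 (C * r) ∧
      ball x (c * r) ×ˢ Set.Ioo 0 (c * r) ⊆ S r) :
    Tendsto (fun r => ⨍ p in S r, |U p - f x| ∂(ν.prod volume)) (𝓝[>] 0) (𝓝 0) := by
  set k := Module.finrank ℝ X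
  -- The factor compares `C * r` times the base volume with the volume of the inner cylinder, of
  -- radius and height `c * r`; the power is `k + 1` because the height counts as one dimension.
  have hlim := (hgx.add hfx).const_mul (C / c ^ (k + 1))
  rw [add_zero, mul_zero] at hlim
  have hsmall : ∀ᶠ r : ℝ in 𝓝[>] 0, closedBall x r ⊆ A ∧ C * r < h := by
    refine nhdsWithin_le_nhds ((eventually_closedBall_subset (hA.mem_nhds hx)).and ?_)
    have : Tendsto (fun r : ℝ => C * r) (𝓝 0) (𝓝 0) :=
      (by fun_prop : Continuous fun r : ℝ => C * r).tendsto' 0 0 (by simp)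
    exact this.eventually (gt_mem_nhds hh)
  have hnn : ∀ r, 0 ≤ ⨍ p in S r, |U p - f x| ∂(ν.prod volume) := fun r => by
    rw [setAverage_eq]
    exact smul_nonneg (inv_nonneg.2 measureReal_nonneg) (integral_nonneg fun p => abs_nonneg _)
  refine squeeze_zero' (Eventually.of_forall hnn) ?_ hlim
  filter_upwards [hS, hsmall, self_mem_nhdsWithin] with r ⟨hr1, hr2⟩ ⟨hr3, hr4⟩ (hr : 0 < r)
  set Q := closedBall x r ×ˢ Set.Ioc 0 (C * r) with hQ
  have hm : 0 < ν.real (ball 0 1) := by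
    refine ENNReal.toReal_pos (measure_ball_pos _ _ one_pos).ne' measure_ball_lt_top.ne
  have hCr : 0 ≤ C * r := by positivity
  have hQfin : (ν.prod volume) Q ≠ ⊤ := by
    rw [hQ, Measure.prod_prod, Real.volume_Ioc]
    exact ENNReal.mul_ne_top measure_closedBall_lt_top.ne ENNReal.ofReal_ne_top
  have hUa : IntegrableOn (fun p => |U p - f x|) Q (ν.prod volume) :=
    (hU.integrableOn.sub (integrableOn_const hQfin)).abs
  have hNi : Integrable (fun y => ∫ τ in Set.Ioc 0 (C * r), |g (y, τ)|) ν :=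
    (Integrable.restrict_snd hg.abs _).integral_prod_left
  have hfi : IntegrableOn (fun y => |f y - f x|) (closedBall x r) ν :=
    (hf.integrableOn.sub (integrableOn_const measure_closedBall_lt_top.ne)).abs
  have hupper : ∫ p in S r, |U p - f x| ∂(ν.prod volume) ≤
      C * r * ((∫ y in closedBall x r, (∫ τ in Set.Ioc 0 (C * r), |g (y, τ)|) ∂ν) +
        ∫ y in closedBall x r, |f y - f x| ∂ν) := by
    calc ∫ p in S r, |U p - f x| ∂(ν.prod volume)
      _ ≤ ∫ p in Q, |U p - f x| ∂(ν.prod volume) :=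
        setIntegral_mono_set hUa (Eventually.of_forall fun p => abs_nonneg _)
          (LE.le.eventuallyLE hr1)
      _ = ∫ y in closedBall x r, (∫ t in Set.Ioc 0 (C * r), |U (y, t) - f x|) ∂ν :=
        setIntegral_prod _ hUa
      -- On each fibre, `|U - f x|` is split through `f y`; the fibre rate is enlarged to the full
      -- height `C * r`, after which the integrand no longer depends on `t`.
      _ ≤ ∫ y in closedBall x r, (C * r * ((∫ τ in Set.Ioc 0 (C * r), |g (y, τ)|) +
            |f y - f x|)) ∂ν := by
        refine integral_mono_of_nonneg (Eventually.of_forall fun y =>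
          integral_nonneg fun t => abs_nonneg _) ((hNi.integrableOn.add hfi).const_mul _) ?_
        filter_upwards [ae_restrict_mem measurableSet_closedBall, ae_restrict_of_ae hb,
          ae_restrict_of_ae hg.prod_right_ae] with y hy1 hy2 hy3
        have hv : (volume : Measure ℝ).real (Set.Ioc 0 (C * r)) = C * r := by
          rw [measureReal_def, Real.volume_Ioc, sub_zero, ENNReal.toReal_ofReal hCr]
        calc ∫ t in Set.Ioc 0 (C * r), |U (y, t) - f x|
          _ ≤ ∫ t in Set.Ioc 0 (C * r), ((∫ τ in Set.Ioc 0 (C * r), |g (y, τ)|) +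
              |f y - f x|) := by
            refine integral_mono_of_nonneg (Eventually.of_forall fun t => abs_nonneg _)
              (integrableOn_const measure_Ioc_lt_top.ne) ?_
            filter_upwards [ae_restrict_mem measurableSet_Ioc,
              ae_restrict_of_ae (hy2 (hr3 hy1))] with t ht1 ht2
            have h1 := ht2 ht1.1 (ht1.2.trans_lt hr4)
            have h2 : ∫ τ in Set.Ioc 0 t, |g (y, τ)| ≤ ∫ τ in Set.Ioc 0 (C * r), |g (y, τ)| :=
              setIntegral_mono_set hy3.abs.integrableOn
                (Eventually.of_forall fun τ => abs_nonneg _)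
                (LE.le.eventuallyLE (Set.Ioc_subset_Ioc_right ht1.2))
            have h3 := abs_sub_le (U (y, t)) (f y) (f x)
            linarith
          _ = C * r * ((∫ τ in Set.Ioc 0 (C * r), |g (y, τ)|) + |f y - f x|) := by
            rw [setIntegral_const, hv, smul_eq_mul]
      _ = _ := by
        rw [integral_const_mul, integral_add hNi.integrableOn hfi]
  have hSfin : (ν.prod volume) (S r) ≠ ⊤ := measure_ne_top_of_subset hr1 hQfin
  have hlower : (c * r) ^ k * ν.real (ball 0 1) * (c * r) ≤ (ν.prod volume).real (S r) := by
    have hcr : 0 < c * r := by positivity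
    calc (c * r) ^ k * ν.real (ball 0 1) * (c * r)
      _ = (ν.prod volume).real (ball x (c * r) ×ˢ Set.Ioo 0 (c * r)) := by
        rw [measureReal_prod_prod, measureReal_def, measureReal_def, measureReal_def,
          Measure.addHaar_ball_of_pos ν x hcr, Real.volume_Ioo, ENNReal.toReal_mul,
          ENNReal.toReal_ofReal (by positivity), sub_zero, ENNReal.toReal_ofReal hcr.le]
      _ ≤ _ := measureReal_mono hr2 hSfin
  have halg : ∀ T m : ℝ, 0 < m → ((c * r) ^ k * m * (c * r))⁻¹ * (C * r * T) =
      C / c ^ (k + 1) * ((r ^ k * m)⁻¹ * T) := fun T m hm => by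
    rw [mul_pow, pow_succ]
    field_simp
  rw [setAverage_eq, setAverage_eq, setAverage_eq, smul_eq_mul, smul_eq_mul, smul_eq_mul,
    ← mul_add, Measure.addHaar_real_closedBall ν x hr.le]
  refine (mul_le_mul (inv_anti₀ (by positivity) hlower) hupper
    (integral_nonneg fun p => abs_nonneg _) (by positivity)).trans (le_of_eq ?_)
  exact halg _ _ hm

end ProductAverage

/-! ### Coordinates adapted to a graph. -/

section Graph

variable {E : Type*} [NormedAddCommGroup E] [InnerProductSpace ℝ E]

/-- The parametrisation of `E` by the hyperplane orthogonal to `e` and the height above the graph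
of `ψ`. -/
noncomputable def graphMap (e : E) (ψ : E → ℝ) (p : (ℝ ∙ e)ᗮ × ℝ) : E :=
  (p.1 : E) + (ψ p.1 + p.2) • e

lemma continuous_graphMap {e : E} {ψ : E → ℝ} (hψ : Continuous ψ) :
    Continuous (graphMap e ψ) := by
  unfold graphMap
  fun_prop

lemma graphMap_add_smul (e : E) (ψ : E → ℝ) (p : (ℝ ∙ e)ᗮ × ℝ) (s : ℝ) :
    graphMap e ψ p + s • e = graphMap e ψ (p.1, p.2 + s) := by
  simp only [graphMap]
  module

lemma inner_coe_orthogonal_span_singleton (e : E) (x : (ℝ ∙ e)ᗮ) : ⟪e, (x : E)⟫ = 0 :=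
  Submodule.mem_orthogonal_singleton_iff_inner_right.1 x.2

lemma inner_graphMap {e : E} (he : ‖e‖ = 1) (ψ : E → ℝ) (p : (ℝ ∙ e)ᗮ × ℝ) :
    ⟪e, graphMap e ψ p⟫ = ψ p.1 + p.2 := by
  rw [graphMap, inner_add_right, inner_coe_orthogonal_span_singleton, inner_smul_right,
    real_inner_self_eq_norm_sq, he]
  ring

lemma graphMap_sub_inner_smul {e : E} (he : ‖e‖ = 1) (ψ : E → ℝ) (p : (ℝ ∙ e)ᗮ × ℝ) :
    graphMap e ψ p - ⟪e, graphMap e ψ p⟫ • e = p.1 := by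
  rw [inner_graphMap he, graphMap, add_sub_cancel_right]

lemma exists_graphMap_eq {e : E} (he : ‖e‖ = 1) (ψ : E → ℝ) (x : E) :
    ∃ p : (ℝ ∙ e)ᗮ × ℝ, graphMap e ψ p = x := by
  have hx : x - ⟪e, x⟫ • e ∈ (ℝ ∙ e)ᗮ := by
    rw [Submodule.mem_orthogonal_singleton_iff_inner_right, inner_sub_right, inner_smul_right,
      real_inner_self_eq_norm_sq, he]
    ring
  refine ⟨(⟨_, hx⟩, ⟪e, x⟫ - ψ (x - ⟪e, x⟫ • e)), ?_⟩
  simp only [graphMap]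
  module

variable [FiniteDimensional ℝ E] [MeasurableSpace E] [BorelSpace E]

/-- The map is a vertical shear followed by the orthogonal decomposition along `e`. The shear
preserves volume for merely continuous `ψ`, so no Jacobian is needed. -/
lemma measurePreserving_graphMap {e : E} (he : ‖e‖ = 1) {ψ : E → ℝ} (hψ : Continuous ψ) :
    MeasurePreserving (graphMap e ψ) (volume.prod volume) volume := by
  have h1 : MeasurePreserving (fun p : (ℝ ∙ e)ᗮ × ℝ => (id p.1, ψ p.1 + p.2))
      (volume.prod volume) (volume.prod volume) :=
    (MeasurePreserving.id _).skew_product (g := fun (x : (ℝ ∙ e)ᗮ) t => ψ x + t)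
      (by fun_prop) (Eventually.of_forall fun x => map_add_left_eq_self volume (ψ x))
  have h2 : MeasurePreserving (Prod.map (LinearIsometryEquiv.toSpanUnitSingleton (𝕜 := ℝ) e he)
      (id : (ℝ ∙ e)ᗮ → (ℝ ∙ e)ᗮ)) (volume.prod volume) (volume.prod volume) :=
    (LinearIsometryEquiv.toSpanUnitSingleton (𝕜 := ℝ) e he).measurePreserving.prod
      (MeasurePreserving.id _)
  have h3 := WithLp.volume_preserving_toLp (ℝ ∙ e) (ℝ ∙ e)ᗮ
  have h4 := ((ℝ ∙ e).orthogonalDecomposition).symm.measurePreserving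
  have h5 := h4.comp (h3.comp (h2.comp (Measure.measurePreserving_swap.comp h1)))
  convert! h5 using 1
  ext p
  simp [graphMap, add_comm]

end Graph

/-! ### Half balls and cylinders in graph coordinates. -/

section GraphGeometry

variable {E : Type*} [NormedAddCommGroup E] [InnerProductSpace ℝ E]

lemma norm_coe_le_norm_add_smul (e : E) (x : (ℝ ∙ e)ᗮ) (t : ℝ) :
    ‖x‖ ≤ ‖(x : E) + t • e‖ := by
  refine abs_le_of_sq_le_sq' ?_ (norm_nonneg _) |>.2
  rw [norm_add_sq_real, inner_smul_right, real_inner_comm, inner_coe_orthogonal_span_singleton,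
    Submodule.coe_norm]
  nlinarith [sq_nonneg ‖t • e‖]

lemma graphMap_sub_graphMap (e : E) (ψ : E → ℝ) (p q : (ℝ ∙ e)ᗮ × ℝ) :
    graphMap e ψ p - graphMap e ψ q =
      ((p.1 - q.1 : (ℝ ∙ e)ᗮ) : E) + (ψ p.1 - ψ q.1 + (p.2 - q.2)) • e := by
  rw [graphMap, graphMap, Submodule.coe_sub]
  module

/-- Preimages under `graphMap` of small half balls at a boundary point are comparable to
cylinders. -/
lemma eventually_preimage_graphMap_cylinder {Ω : Set E} {z₀ e : E} {R : ℝ} {ψ : E → ℝ}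
    (he : ‖e‖ = 1) (hgr : ∀ x ∈ ball z₀ R, x ∈ Ω ↔ ψ (x - ⟪e, x⟫ • e) < ⟪e, x⟫)
    {A : Set (ℝ ∙ e)ᗮ} (hA : IsOpen A) {K : NNReal}
    (hK : LipschitzOnWith K (fun x : (ℝ ∙ e)ᗮ => ψ x) A) {x : (ℝ ∙ e)ᗮ} (hx : x ∈ A)
    (hz : graphMap e ψ (x, 0) ∈ ball z₀ R) :
    ∀ᶠ r in 𝓝[>] (0 : ℝ),
      graphMap e ψ ⁻¹' (ball (graphMap e ψ (x, 0)) r ∩ Ω) ⊆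
        closedBall x r ×ˢ Set.Ioc 0 ((1 + K) * r) ∧
      ball x (1 / (2 + K) * r) ×ˢ Set.Ioo 0 (1 / (2 + K) * r) ⊆
        graphMap e ψ ⁻¹' (ball (graphMap e ψ (x, 0)) r ∩ Ω) := by
  have hsmall : ∀ᶠ r : ℝ in 𝓝[>] 0, closedBall x r ⊆ A ∧
      closedBall (graphMap e ψ (x, 0)) r ⊆ ball z₀ R :=
    nhdsWithin_le_nhds ((eventually_closedBall_subset (hA.mem_nhds hx)).and
      (eventually_closedBall_subset (isOpen_ball.mem_nhds hz)))
  filter_upwards [hsmall, self_mem_nhdsWithin] with r ⟨hr1, hr2⟩ (hr : 0 < r)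
  have hΩ : ∀ p, graphMap e ψ p ∈ ball (graphMap e ψ (x, 0)) r →
      (graphMap e ψ p ∈ Ω ↔ 0 < p.2) := fun p hp => by
    rw [hgr _ (hr2 (ball_subset_closedBall hp)), graphMap_sub_inner_smul he, inner_graphMap he,
      lt_add_iff_pos_right]
  have hψ : ∀ y ∈ A, |ψ y - ψ x| ≤ K * ‖y - x‖ := fun y hy => by
    simpa only [dist_eq_norm, Real.norm_eq_abs] using hK.dist_le_mul y hy x hx
  have hK0 : 0 ≤ (K : ℝ) := K.2
  constructor
  · rintro p ⟨hp1, hp2⟩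
    have hpos := (hΩ p hp1).1 hp2
    rw [mem_ball, dist_eq_norm] at hp1
    have h1 : ‖p.1 - x‖ ≤ r := by
      rw [graphMap_sub_graphMap] at hp1
      exact (norm_coe_le_norm_add_smul e _ _).trans hp1.le
    have h2 : p.1 ∈ closedBall x r := by rwa [mem_closedBall, dist_eq_norm]
    -- The component along `e` contributes at most `r` to the height and the variation of `ψ` at
    -- most `K * r`, which gives the outer height `(1 + K) * r`.
    have h3 : ψ p.1 + p.2 - ψ x ≤ r := by
      have := (abs_real_inner_le_norm e (graphMap e ψ p - graphMap e ψ (x, 0))).trans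
        (by rw [he, one_mul])
      rw [inner_sub_right, inner_graphMap he, inner_graphMap he, add_zero] at this
      exact (le_abs_self _).trans (this.trans hp1.le)
    refine ⟨h2, hpos, ?_⟩
    have h4 := (abs_le.1 (hψ _ (hr1 h2))).1
    have h5 := mul_le_mul_of_nonneg_left h1 hK0
    linarith
  · rintro p ⟨hp1, hp2, hp3⟩
    rw [mem_ball, dist_eq_norm] at hp1
    -- Three contributions must fit into `r`: horizontal displacement `c * r`, variation of the
    -- graph `K * (c * r)`, and height `c * r`.
    set c : ℝ := 1 / (2 + K) with hc
    have hcr : c * r + K * (c * r) + c * r = r := by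
      rw [hc]
      field_simp
      ring
    have hcr' : c * r ≤ r := by nlinarith [norm_nonneg (p.1 - x)]
    have h2 : p.1 ∈ closedBall x r := by
      rw [mem_closedBall, dist_eq_norm]
      exact hp1.le.trans hcr'
    have h3 : graphMap e ψ p ∈ ball (graphMap e ψ (x, 0)) r := by
      rw [mem_ball, dist_eq_norm, graphMap_sub_graphMap]
      refine (norm_add_le _ _).trans_lt ?_
      rw [norm_smul, he, mul_one, Real.norm_eq_abs, ← Submodule.coe_norm, sub_zero]
      have h4 := abs_add_le (ψ p.1 - ψ x) p.2
      rw [abs_of_pos hp2] at h4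
      have h5 := hψ _ (hr1 h2)
      have h6 := mul_le_mul_of_nonneg_left hp1.le hK0
      linarith
    exact ⟨h3, (hΩ p h3).2 hp2⟩

end GraphGeometry

/-! ### Boundary values in a graph neighbourhood. -/

section LocalTrace

variable {d : ℕ} {Ω : Set (EuclideanSpace ℝ (Fin d))}

lemma IsWeakGradient.setIntegral_mul_fderiv {u : EuclideanSpace ℝ (Fin d) → ℝ}
    {G : EuclideanSpace ℝ (Fin d) → EuclideanSpace ℝ (Fin d)} (h : IsWeakGradient Ω u G)
    (hu : IntegrableOn u Ω) (hG : IntegrableOn G Ω) {φ : EuclideanSpace ℝ (Fin d) → ℝ}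
    (hφ : IsTestFunction Ω φ) (e : EuclideanSpace ℝ (Fin d)) :
    ∫ x in Ω, u x * fderiv ℝ φ x e = -∫ x in Ω, φ x * ⟪e, G x⟫ := by
  obtain ⟨M, hM⟩ := hφ.hasCompactSupport.exists_bound_of_continuous hφ.smooth.continuous
  have hgc : Continuous (∇ φ) := hφ.smooth.continuous_gradient (by simp)
  obtain ⟨M', hM'⟩ := hφ.hasCompactSupport.gradient.exists_bound_of_continuous hgc
  have i1 : IntegrableOn (fun x => u x • ∇ φ x) Ω :=
    hu.smul_bdd M' hgc.aestronglyMeasurable (Eventually.of_forall hM')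
  have i2 : IntegrableOn (fun x => φ x • G x) Ω :=
    hG.bdd_smul M hφ.smooth.continuous.aestronglyMeasurable (Eventually.of_forall hM)
  have h1 := integral_inner (𝕜 := ℝ) i1 e
  have h2 := integral_inner (𝕜 := ℝ) i2 e
  rw [h φ hφ, inner_neg_right, ← h2] at h1
  simp only [inner_smul_right] at h1
  rw [← h1]
  refine integral_congr_ae (Eventually.of_forall fun x => ?_)
  exact congrArg (u x * ·) (((real_inner_comm _ _).trans inner_gradient_left).symm)

lemma setAverage_abs_sub_eq_preimage_graphMap {e : EuclideanSpace ℝ (Fin d)} (he : ‖e‖ = 1)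
    {ψ : EuclideanSpace ℝ (Fin d) → ℝ} (hψ : Continuous ψ) {u v : EuclideanSpace ℝ (Fin d) → ℝ}
    (hv : StronglyMeasurable v) {B : Set (EuclideanSpace ℝ (Fin d))} (hB : MeasurableSet B)
    (huv : u =ᵐ[volume.restrict B] v) (a : ℝ) :
    ⨍ x in B, |u x - a| = ⨍ p in graphMap e ψ ⁻¹' B, |v (graphMap e ψ p) - a|
      ∂(volume.prod volume) := by
  have hmp := (measurePreserving_graphMap he hψ).restrict_preimage hB
  have hmeas : AEStronglyMeasurable (fun x => |v x - a|) (volume.restrict B) := by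
    have := (hv.sub (stronglyMeasurable_const (b := a))).norm
    simpa only [Pi.sub_apply, Real.norm_eq_abs] using this.aestronglyMeasurable
  have h1 : ∫ x in B, |u x - a| = ∫ x in B, |v x - a| :=
    integral_congr_ae (huv.mono fun x hx => by simp only [hx])
  have h2 : ∫ x in B, |v x - a| = ∫ p in graphMap e ψ ⁻¹' B, |v (graphMap e ψ p) - a|
      ∂(volume.prod volume) := by
    rw [← hmp.map_eq] at hmeas
    conv_lhs => rw [← hmp.map_eq]
    exact integral_map hmp.measurable.aemeasurable hmeas
  rw [setAverage_eq, setAverage_eq, h1, h2, measureReal_def, measureReal_def,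
    (measurePreserving_graphMap he hψ).measure_preimage hB.nullMeasurableSet]

/-- In a graph neighbourhood, a `W^{1,1}` function has a boundary value above almost every point
of the base. -/
lemma MemW11.ae_hasBoundaryValueAt_graphMap {u : EuclideanSpace ℝ (Fin d) → ℝ}
    (hΩ : IsOpen Ω) (hu : MemW11 Ω u) {z₀ e : EuclideanSpace ℝ (Fin d)} {R : ℝ}
    {ψ : EuclideanSpace ℝ (Fin d) → ℝ} (he : ‖e‖ = 1) (hψ : Continuous ψ)
    (hgr : ∀ x ∈ ball z₀ R, x ∈ Ω ↔ ψ (x - ⟪e, x⟫ • e) < ⟪e, x⟫)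
    {A : Set (ℝ ∙ e)ᗮ} (hA : IsOpen A) {K : NNReal}
    (hK : LipschitzOnWith K (fun x : (ℝ ∙ e)ᗮ => ψ x) A) {h : ℝ} (hh : 0 < h)
    (hAh : ∀ x ∈ A, ∀ t, 0 ≤ t → t < h → graphMap e ψ (x, t) ∈ ball z₀ R) :
    ∀ᵐ x : (ℝ ∙ e)ᗮ, x ∈ A → ∃ a, HasBoundaryValueAt Ω u (graphMap e ψ (x, 0)) a := by
  obtain ⟨hui, G, hGi, hG⟩ := hu
  have hmp := measurePreserving_graphMap he hψ
  have hΩm := hΩ.measurableSet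
  have hgi : IntegrableOn (fun x => ⟪e, G x⟫) Ω := hGi.const_inner e
  have hI := (integrable_indicator_iff hΩm).2 hui
  have hJ := (integrable_indicator_iff hΩm).2 hgi
  -- Strongly measurable representatives of the extensions by zero: the fibre argument needs
  -- measurability on the whole product. Test functions supported in `Ω` do not see the extension.
  set v := hI.1.mk with hv
  set w := hJ.1.mk with hw
  have hvm : StronglyMeasurable v := hI.1.stronglyMeasurable_mk
  have hwm : StronglyMeasurable w := hJ.1.stronglyMeasurable_mk
  have huv : Ω.indicator u =ᵐ[volume] v := hI.1.ae_eq_mk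
  have hgw : Ω.indicator (fun x => ⟪e, G x⟫) =ᵐ[volume] w := hJ.1.ae_eq_mk
  have hvi : Integrable v := hI.congr huv
  have hwi : Integrable w := hJ.congr hgw
  have hweak : ∀ φ : EuclideanSpace ℝ (Fin d) → ℝ, ContDiff ℝ ∞ φ → HasCompactSupport φ →
      tsupport φ ⊆ Ω → ∫ x, v x * fderiv ℝ φ x e = -∫ x, φ x * w x := by
    intro φ h1 h2 h3
    have h4 := hG.setIntegral_mul_fderiv hui hGi ⟨h1, h2, h3⟩ e
    rw [← integral_indicator hΩm, ← integral_indicator hΩm] at h4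
    convert h4 using 1
    · refine integral_congr_ae (huv.mono fun x hx => ?_)
      simp only [← hx, Set.indicator_mul_left]
    · congr 1
      refine integral_congr_ae (hgw.mono fun x hx => ?_)
      simp only [← hx, Set.indicator_mul_right]
  have hV : Integrable (v ∘ graphMap e ψ) (volume.prod volume) := hmp.integrable_comp_of_integrable hvi
  have hW : Integrable (w ∘ graphMap e ψ) (volume.prod volume) := hmp.integrable_comp_of_integrable hwi
  obtain ⟨f, hf, hb⟩ := exists_fibre_trace (U := v ∘ graphMap e ψ) (g := w ∘ graphMap e ψ)
    (hvm.comp_measurable hmp.measurable) hV (hwm.comp_measurable hmp.measurable) hW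
    hA.measurableSet hh (fun s hs => by
      filter_upwards [hmp.quasiMeasurePreserving.ae
        (ae_sub_eq_setIntegral_of_weak_lineDeriv hΩ hvi hwi hweak hs)] with p hp h1 h2 h3
      simp only [graphMap_add_smul] at hp
      -- The segment stays at positive heights inside the graph ball, hence in `Ω`.
      refine (hp fun τ hτ => ?_).trans ?_
      · rw [hgr _ (hAh _ h1 _ (by linarith [hτ.1]) (by linarith [hτ.2])),
          graphMap_sub_inner_smul he, inner_graphMap he]
        simp only
        linarith [hτ.1]
      · rw [← intervalIntegral.integral_of_le hs, ← intervalIntegral.integral_of_le (by linarith)]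
        have := intervalIntegral.integral_comp_add_left (a := 0) (b := s)
          (fun τ => w (graphMap e ψ (p.1, τ))) p.2
        rw [add_zero] at this
        exact this)
  filter_upwards [hb, ae_tendsto_average_abs_sub hf,
    ae_tendsto_average_setIntegral_abs hW (1 + K)] with x hx h1 h2 hxA
  refine ⟨f x, ?_⟩
  have hcyl := eventually_preimage_graphMap_cylinder he hgr hA hK hxA (hAh x hxA 0 le_rfl hh)
  have := tendsto_average_abs_sub_fibre_trace hV hW hf hA (half_pos hh) hb
    (by positivity : (0 : ℝ) < 1 / (2 + K)) (by positivity : (0 : ℝ) < 1 + K) hxA h1 h2 hcyl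
  refine this.congr fun r => ?_
  refine (setAverage_abs_sub_eq_preimage_graphMap he hψ hvm
    (measurableSet_ball.inter hΩm) ?_ (f x)).symm
  filter_upwards [ae_restrict_of_ae huv, ae_restrict_mem (measurableSet_ball.inter hΩm)] with y h1 h2
  rw [← h1, Set.indicator_of_mem h2.2]

end LocalTrace

/-! ### Traces for the Hausdorff measure on the boundary, and the conclusion. -/

section Boundary

variable {d : ℕ} {Ω : Set (EuclideanSpace ℝ (Fin d))}

lemma finrank_orthogonal_span_unit {e : EuclideanSpace ℝ (Fin d)} (he : ‖e‖ = 1) :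
    (Module.finrank ℝ (ℝ ∙ e)ᗮ : ℝ) = d - 1 := by
  have h := Submodule.finrank_add_finrank_orthogonal (ℝ ∙ e)
  rw [finrank_span_singleton (norm_ne_zero_iff.1 (he ▸ one_ne_zero)),
    finrank_euclideanSpace_fin] at h
  have h' : (1 : ℝ) + Module.finrank ℝ (ℝ ∙ e)ᗮ = d := mod_cast h
  linarith

/-- Existence of traces: a `W^{1,1}` function on a `C¹` open set has a boundary value at almost
every boundary point. -/
lemma MemW11.ae_exists_hasBoundaryValueAt (hΩ : IsC1OpenSet Ω)
    {u : EuclideanSpace ℝ (Fin d) → ℝ} (hu : MemW11 Ω u) :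
    ∀ᵐ z ∂((Measure.hausdorffMeasure ((d : ℝ) - 1)).restrict (frontier Ω)),
      ∃ a, HasBoundaryValueAt Ω u z a := by
  rw [ae_restrict_iff' isClosed_frontier.measurableSet, ae_iff]
  -- It suffices to show that each bad boundary point has a neighbourhood in which the bad points
  -- form a null set, so a single graph chart can be used.
  refine measure_null_of_locally_null _ fun z hz => ?_
  have hzf : z ∈ frontier Ω := (Classical.not_imp.1 hz).1
  obtain ⟨R, hR, e, he, ψ, hψ, hgr⟩ := hΩ.exists_graph z hzf
  have hflat : ∀ p : (ℝ ∙ e)ᗮ × ℝ, graphMap e ψ p ∈ ball z R → graphMap e ψ p ∈ frontier Ω →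
      p.2 = 0 := fun p h1 h2 => by
    have := IsC1OpenSet.graph_of_mem_frontier hΩ.isOpen hψ.continuous hgr h1 h2
    rw [graphMap_sub_inner_smul he, inner_graphMap he] at this
    linarith
  obtain ⟨⟨x₀, t₀⟩, hx₀⟩ := exists_graphMap_eq he ψ z
  obtain rfl : t₀ = 0 := hflat (x₀, t₀) (hx₀ ▸ mem_ball_self hR) (hx₀ ▸ hzf)
  have hcoe : ContDiff ℝ 1 (fun x : (ℝ ∙ e)ᗮ => ψ x) := hψ.comp (ℝ ∙ e)ᗮ.subtypeL.contDiff
  have hgraph : ContDiff ℝ 1 (fun x : (ℝ ∙ e)ᗮ => graphMap e ψ (x, 0)) := by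
    simp only [graphMap]
    exact (ℝ ∙ e)ᗮ.subtypeL.contDiff.add ((hcoe.add contDiff_const).smul contDiff_const)
  obtain ⟨K, T, hT, hK⟩ := hcoe.contDiffAt.exists_lipschitzOnWith (x := x₀)
  obtain ⟨L, T', hT', hL⟩ := hgraph.contDiffAt.exists_lipschitzOnWith (x := x₀)
  have hnear : ∀ᶠ p in 𝓝 (x₀, (0 : ℝ)), graphMap e ψ p ∈ ball z R :=
    (continuous_graphMap hψ.continuous).continuousAt.eventually_mem
      (hx₀ ▸ isOpen_ball.mem_nhds (mem_ball_self hR))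
  rw [nhds_prod_eq, Filter.eventually_prod_iff] at hnear
  obtain ⟨pa, hpa, pb, hpb, hab⟩ := hnear
  obtain ⟨ρ, hρ, hρs⟩ := Metric.mem_nhds_iff.1 (Filter.inter_mem (Filter.inter_mem hT hT') hpa)
  obtain ⟨h, hh, hhs⟩ := Metric.mem_nhds_iff.1 hpb
  have htrace := hu.ae_hasBoundaryValueAt_graphMap hΩ.isOpen he hψ.continuous hgr
    (isOpen_ball (x := x₀) (ε := ρ)) (hK.mono fun x hx => (hρs hx).1.1) hh
    (fun x hx t ht0 hth => hab (hρs hx).2 (hhs (by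
      rw [mem_ball, Real.dist_0_eq_abs, abs_of_nonneg ht0]
      exact hth)))
  set N : Set (ℝ ∙ e)ᗮ := {x | ¬ (x ∈ ball x₀ ρ → ∃ a, HasBoundaryValueAt Ω u (graphMap e ψ (x, 0)) a)}
    with hN
  have hN0 : volume N = 0 := ae_iff.1 htrace
  -- On the hyperplane, of dimension `d - 1`, Hausdorff measure is absolutely continuous with
  -- respect to volume; the Lipschitz parametrisation then carries null sets to null sets.
  have hNH : Measure.hausdorffMeasure ((d : ℝ) - 1) N = 0 := by
    rw [← finrank_orthogonal_span_unit he]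
    exact Measure.absolutelyContinuous_isAddHaarMeasure _ volume hN0
  have hd0 : 0 ≤ (d : ℝ) - 1 := by
    rw [← finrank_orthogonal_span_unit he]
    positivity
  have himage : Measure.hausdorffMeasure ((d : ℝ) - 1)
      ((fun x : (ℝ ∙ e)ᗮ => graphMap e ψ (x, 0)) '' N) = 0 := by
    have hLN : LipschitzOnWith L (fun x : (ℝ ∙ e)ᗮ => graphMap e ψ (x, 0)) N :=
      hL.mono fun x hx => (hρs (Classical.not_imp.1 hx).1).1.2
    refine le_antisymm ((hLN.hausdorffMeasure_image_le hd0).trans ?_) zero_le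
    rw [hNH, mul_zero]
  have hopen : IsOpen {w : EuclideanSpace ℝ (Fin d) | ‖w - ⟪e, w⟫ • e - x₀‖ < ρ} :=
    isOpen_lt (by fun_prop) continuous_const
  have hzmem : z ∈ {w : EuclideanSpace ℝ (Fin d) | ‖w - ⟪e, w⟫ • e - x₀‖ < ρ} := by
    rw [← hx₀, Set.mem_ofPred_eq, graphMap_sub_inner_smul he, sub_self, norm_zero]
    exact hρ
  refine ⟨_, inter_mem_nhdsWithin _ ((hopen.inter isOpen_ball).mem_nhds
    ⟨hzmem, mem_ball_self hR⟩), measure_mono_null ?_ himage⟩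
  rintro w ⟨hw1, hw2, hw3⟩
  obtain ⟨hwf, hwt⟩ := Classical.not_imp.1 hw1
  obtain ⟨⟨x, t⟩, rfl⟩ := exists_graphMap_eq he ψ w
  obtain rfl : t = 0 := hflat (x, t) hw3 hwf
  refine ⟨x, fun hx => hwt (hx ?_), rfl⟩
  rw [Set.mem_ofPred_eq, graphMap_sub_inner_smul he] at hw2
  rwa [mem_ball, dist_eq_norm]

/-- The tangential direction of oscillation: in dimension at least two the orthogonal complement of
a line is nonzero. -/
lemma exists_norm_eq_one_inner_eq_zero (hd : 2 ≤ d) (n : EuclideanSpace ℝ (Fin d)) :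
    ∃ b : EuclideanSpace ℝ (Fin d), ‖b‖ = 1 ∧ ⟪n, b⟫ = 0 := by
  have hlt : Module.finrank ℝ (ℝ ∙ n) < Module.finrank ℝ (EuclideanSpace ℝ (Fin d)) := by
    have := finrank_span_le_card (R := ℝ) ({n} : Set (EuclideanSpace ℝ (Fin d)))
    rw [finrank_euclideanSpace_fin]
    simp only [Set.toFinset_singleton, Finset.card_singleton] at this
    exact this.trans_lt hd
  have hne : (ℝ ∙ n)ᗮ ≠ ⊥ := fun h => by
    have := Submodule.finrank_add_finrank_orthogonal (ℝ ∙ n)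
    rw [h, finrank_bot] at this
    lia
  obtain ⟨v, hv, hv0⟩ := Submodule.exists_mem_ne_zero_of_ne_bot hne
  refine ⟨‖v‖⁻¹ • v, norm_smul_inv_norm (𝕜 := ℝ) hv0, ?_⟩
  rw [inner_smul_right, Submodule.mem_orthogonal_singleton_iff_inner_right.1 hv, mul_zero]

lemma MemW11.exists_isElliptic {γ : EuclideanSpace ℝ (Fin d) → ℝ} (hγ : MemW11 Ω γ)
    (hell : ∃ l : ℝ, 0 < l ∧ ∀ᵐ x ∂(volume.restrict Ω), 1 / l ≤ γ x ∧ γ x ≤ l) :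
    ∃ l, IsElliptic Ω γ l := by
  obtain ⟨l, hl, h⟩ := hell
  exact ⟨l, hγ.1.aestronglyMeasurable, hl, h⟩

/-- Conductivities with the same Dirichlet-to-Neumann map have ordered boundary values; by
symmetry these coincide. -/
lemma boundaryValue_le_of_DtN_eq (hd : 2 ≤ d) (hbdd : Bornology.IsBounded Ω)
    (hΩ : IsC1OpenSet Ω) {γ₁ γ₂ : EuclideanSpace ℝ (Fin d) → ℝ} {l₁ l₂ : ℝ}
    (h₁ : IsElliptic Ω γ₁ l₁) (h₂ : IsElliptic Ω γ₂ l₂)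
    (hi₁ : IntegrableOn γ₁ Ω) (hi₂ : IntegrableOn γ₂ Ω) (hDtN : DtN Ω γ₁ = DtN Ω γ₂)
    {z : EuclideanSpace ℝ (Fin d)} (hz : z ∈ frontier Ω) {a₁ a₂ : ℝ}
    (ha₁ : HasBoundaryValueAt Ω γ₁ z a₁) (ha₂ : HasBoundaryValueAt Ω γ₂ z a₂) : a₂ ≤ a₁ := by
  obtain ⟨n, hn, hblow⟩ := hΩ.exists_inner_normal hz
  obtain ⟨b, hb, hnb⟩ := exists_norm_eq_one_inner_eq_zero hd n
  have key : ∀ ε > 0, 0 < a₂ ∧ a₂ * (1 - ε) ≤ a₁ := fun ε hε => by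
    obtain ⟨V, W, hV, hcV, hW, hcW, hpos, hle⟩ :=
      exists_almost_conjugate (μ := volume) hn hb hnb hε
    obtain ⟨hpos₂, h⟩ := boundaryValue_mul_dual_energy_le hd hbdd hΩ.isOpen h₁ h₂ hi₁ hi₂ hDtN hn
      hblow ha₁ ha₂ hV hcV hW hcW n b hpos
    refine ⟨hpos₂, le_of_mul_le_mul_right (le_trans ?_ h) hpos⟩
    rw [mul_assoc]
    refine mul_le_mul_of_nonneg_left ?_ hpos₂.le
    linarith
  -- With relative error `δ / a₂` the loss in `a₂ * (1 - ε)` is exactly `δ`; the choice `ε = 1` is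
  -- used only to extract `0 < a₂`.
  refine le_of_forall_pos_le_add fun δ hδ => ?_
  have h0 := (key 1 one_pos).1
  have h1 := (key (δ / a₂) (by positivity)).2
  rw [mul_sub, mul_one, mul_div_cancel₀ _ h0.ne'] at h1
  linarith

end Boundary

theorem propositionB1 (d : ℕ) (hd : 2 ≤ d) (Ω : Set (EuclideanSpace ℝ (Fin d)))
    (hbdd : Bornology.IsBounded Ω) (hΩ : IsC1OpenSet Ω)
    (γ₁ γ₂ : EuclideanSpace ℝ (Fin d) → ℝ)
    (hγ₁ : MemW11 Ω γ₁) (hγ₂ : MemW11 Ω γ₂)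
    (hell₁ : ∃ l : ℝ, 0 < l ∧ ∀ᵐ x ∂(volume.restrict Ω), 1 / l ≤ γ₁ x ∧ γ₁ x ≤ l)
    (hell₂ : ∃ l : ℝ, 0 < l ∧ ∀ᵐ x ∂(volume.restrict Ω), 1 / l ≤ γ₂ x ∧ γ₂ x ≤ l)
    (hDtN : DtN Ω γ₁ = DtN Ω γ₂) :
    ∀ᵐ z ∂((Measure.hausdorffMeasure ((d : ℝ) - 1)).restrict (frontier Ω)),
      ∃ a : ℝ, HasBoundaryValueAt Ω γ₁ z a ∧ HasBoundaryValueAt Ω γ₂ z a := by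
  obtain ⟨l₁, h₁⟩ := hγ₁.exists_isElliptic hell₁
  obtain ⟨l₂, h₂⟩ := hγ₂.exists_isElliptic hell₂
  filter_upwards [hγ₁.ae_exists_hasBoundaryValueAt hΩ, hγ₂.ae_exists_hasBoundaryValueAt hΩ,
    ae_restrict_mem isClosed_frontier.measurableSet] with z ⟨a₁, ha₁⟩ ⟨a₂, ha₂⟩ hz
  obtain rfl : a₁ = a₂ := le_antisymm
    (boundaryValue_le_of_DtN_eq hd hbdd hΩ h₂ h₁ hγ₂.1 hγ₁.1 hDtN.symm hz ha₂ ha₁)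
    (boundaryValue_le_of_DtN_eq hd hbdd hΩ h₁ h₂ hγ₁.1 hγ₂.1 hDtN hz ha₁ ha₂)
  exact ⟨a₁, ha₁, ha₂⟩
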